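/- **Definitions.** A *generalized analytic holonomy set* is (the germ at $0$ of) an analytic set $\mathcal X\subset\mathbb C^4$ with coordinates $(u_1,v_1,u_2,v_2)$, defined near $0$ by holomorphic functions $$v_i(u_1,u_2)=\tau_iu_i+\sum_{l\ge 3\text{ odd}}\ \sum_{j+k=l}c^i_{jk}u_1^ju_2^k\qquad(i=1,2)$$ such that: (a) $\operatorname{Im}\tau_i>0$; (b) $v_1(u_1,0)\not\equiv\tau_1u_1$ and $v_2(0,u_2)\not\equiv\tau_2u_2$; (c) $v_1$ is odd in $u_1$ and even in $u_2$, and $v_2$ is even in $u_1$ and odd in $u_2$; (d) $\partial v_1/\partial u_2=a\,\partial v_2/\partial u_1$ for some $a\in\mathbb C$; (e) every subgroup of $\operatorname{Aut}\mathcal X$ contained in $\mathrm{GL}_4(\mathbb Q)$ is finite. Here $M\in\mathrm{GL}_4(\mathbb Q)$ lies in $\operatorname{Aut}\mathcal X$ if $\mathbf x\mapsto M\mathbf x$ maps the germ of $\mathcal X$ at $0$ onto itself. The numbers $\tau_1,\tau_2$ are the *cusp shapes* of $\mathcal X$. Write $M=\begin{pmatrix}A_1&A_2\\A_3&A_4\end{pmatrix}\in\mathrm{GL}_4(\mathbb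 Q)$ with $2\times2$ blocks. $M$ is of *Type I* if $A_2=A_3=0$ and $\det A_1=\det A_4=1$; of *Type II* if $A_1=A_4=0$ and $\det A_2=\det A_3=1$; of *Type III* if $\det A_j\ne0$ for $1\le j\le 4$, $\det A_1=\det A_4$, $\det A_2=\det A_3$, $\det A_1+\det A_3=1$ and $(\det A_1)A_1^{-1}A_2=-(\det A_3)A_3^{-1}A_4$. Let $\mathfrak m_N$ be the minimal polynomial of $N$ over $\mathbb Q$, and $\iota=\begin{pmatrix}I&0\\0&-I\end{pmatrix}$. **Theorem.** Let $\mathcal X$ be a generalized analytic holonomy set whose cusp shapes belong to a common quadratic field, and let $M\in\operatorname{Aut}\mathcal X\cap\mathrm{GL}_4(\mathbb Q)$ be of Type III. **(1)** Suppose $A_1$ is not a scalar matrix. Then the cusp shapes of $\mathcal X$ are both contained in $\mathbb Q(\sqrt{-3})$, both in $\mathbb Q(\sqrt{-2})$, or both in $\mathbb Q(\sqrt{-1})$. For each of these fields one of the cases listed under it below holds, and in each case $M$ has the stated form, for some $A_1,A_2\in\mathrm{GL}_2(\mathbb Q)$ with the stated $\mathfrak m_{A_1}$. The signs $\pm$ within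 a case correspond to each other; if $\pm$ occurs only in $\mathfrak m_{A_1}$, one of the two signs holds. (a) Cusp shapes in $\mathbb Q(\sqrt{-3})$. - (i) If $\mathfrak m_M=x^2+1$ (resp. $\mathfrak m_M=x^4+x^2+1$ and $M^2$ is of Type III), then $M=\begin{pmatrix}A_1&A_2\\-\frac14A_2^{-1}&-A_2^{-1}A_1A_2\end{pmatrix}$ (resp. $\begin{pmatrix}A_1&A_2\\\frac14A_2^{-1}&A_2^{-1}A_1A_2\end{pmatrix}$), with $\mathfrak m_{A_1}=x^2+\frac34$. - (ii) If $\mathfrak m_M=x^3\pm1$ (resp. $\mathfrak m_M=x^4+x^2+1$ and $M^2$ is of Type I), then $M=\begin{pmatrix}A_1&A_2\\-3A_2^{-1}A_1^2&A_2^{-1}A_1A_2\end{pmatrix}$ (resp. $\begin{pmatrix}A_1&A_2\\3A_2^{-1}A_1^2&-A_2^{-1}A_1A_2\end{pmatrix}$), with $\mathfrak m_{A_1}=x^2\pm\frac12x+\frac14$. - (iii) If $\mathfrak m_M=x^3\pm2x^2+2x\pm1$ (resp. $\mathfrak m_M=x^4-x^2+1$ and $M^2$ is of Type I), then $M=\begin{pmatrix}A_1&A_2\\-\frac13A_2^{-1}A_1^2&A_2^{-1}A_1A_2\end{pmatrix}$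 (resp. $\begin{pmatrix}A_1&A_2\\\frac13A_2^{-1}A_1^2&-A_2^{-1}A_1A_2\end{pmatrix}$), with $\mathfrak m_{A_1}=x^2\pm\frac32x+\frac34$. (b) Cusp shapes in $\mathbb Q(\sqrt{-2})$. - (i) If $\mathfrak m_M=x^2+1$ (resp. $\mathfrak m_M=x^4+1$ and $M^2$ is of Type II), then $M=\begin{pmatrix}A_1&A_2\\-\frac12A_2^{-1}&-A_2^{-1}A_1A_2\end{pmatrix}$ (resp. $\begin{pmatrix}A_1&A_2\\\frac12A_2^{-1}&A_2^{-1}A_1A_2\end{pmatrix}$), with $\mathfrak m_{A_1}=x^2+\frac12$. - (ii) If $\mathfrak m_M=x^2\pm x+1$ (resp. $\mathfrak m_M=x^4+1$ and $M^2$ is of Type III), then $M=\begin{pmatrix}A_1&A_2\\-\frac14A_2^{-1}&\frac34A_2^{-1}A_1^{-1}A_2\end{pmatrix}$ (resp. $\begin{pmatrix}A_1&A_2\\\frac14A_2^{-1}&-\frac34A_2^{-1}A_1^{-1}A_2\end{pmatrix}$), with $\mathfrak m_{A_1}=x^2\pm x+\frac34$. (c) Cusp shapes in $\mathbb Q(\sqrt{-1})$.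 - (i) If $\mathfrak m_M=x^2+1$ (resp. $\mathfrak m_M=x^4-x^2+1$ and $M^2$ is of Type III with $\mathfrak m_{\iota M^2}=x^2-1$), then $M=\begin{pmatrix}A_1&A_2\\-\frac34A_2^{-1}&-A_2^{-1}A_1A_2\end{pmatrix}$ (resp. $\begin{pmatrix}A_1&A_2\\\frac34A_2^{-1}&A_2^{-1}A_1A_2\end{pmatrix}$), with $\mathfrak m_{A_1}=x^2+\frac14$. - (ii) If $\mathfrak m_M=x^3\pm x^2+x\pm1$ (resp. $\mathfrak m_M=x^4+1$ and $M^2$ is of Type I), then $M=\begin{pmatrix}A_1&A_2\\-A_2^{-1}A_1^2&A_2^{-1}A_1A_2\end{pmatrix}$ (resp. $\begin{pmatrix}A_1&A_2\\A_2^{-1}A_1^2&-A_2^{-1}A_1A_2\end{pmatrix}$), with $\mathfrak m_{A_1}=x^2\pm x+\frac12$. - (iii) If $\mathfrak m_M=x^2\pm x+1$ (resp. $\mathfrak m_M=x^4-x^2+1$ and $M^2$ is of Type III with $\mathfrak m_{\iota M^2}=x^4-x^2+1$), then $M=\begin{pmatrix}A_1&A_2\\-\frac12A_2^{-1}&\frac12A_2^{-1}A_1^{-1}A_2\end{pmatrix}$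 (resp. $\begin{pmatrix}A_1&A_2\\\frac12A_2^{-1}&-\frac12A_2^{-1}A_1^{-1}A_2\end{pmatrix}$), with $\mathfrak m_{A_1}=x^2\pm x+\frac12$. **(2)** Suppose $A_1$ is a scalar matrix. Then $\mathfrak m_M$ is $x^2-1$, $x^2+x+1$ or $x^2-x+1$, and $M$ is respectively of the form $$\begin{pmatrix}\pm\frac I2&A_2\\\frac34A_2^{-1}&\mp\frac I2\end{pmatrix},\qquad\begin{pmatrix}-\frac I2&A_2\\-\frac34A_2^{-1}&-\frac I2\end{pmatrix}\qquad\text{or}\qquad\begin{pmatrix}\frac I2&-A_2\\\frac34A_2^{-1}&\frac I2\end{pmatrix}$$ for some $A_2\in\mathrm{GL}_2(\mathbb Q)$ with $\det A_2=\frac34$. -/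

import Mathlib

open Polynomial Topology Filter

/-- Index set of the coordinates `(u₁, v₁, u₂, v₂)` of `ℂ⁴`, in this order:
`inl 0` is `u₁`, `inl 1` is `v₁`, `inr 0` is `u₂`, `inr 1` is `v₂`.  A `4 × 4` matrix over this
index set is a `2 × 2` array of `2 × 2` blocks. -/
abbrev Coord : Type := Fin 2 ⊕ Fin 2

/-- `2 × 2` rational matrices. -/
abbrev Mat2 : Type := Matrix (Fin 2) (Fin 2) ℚ

/-- `4 × 4` rational matrices, split into `2 × 2` blocks. -/
abbrev Mat4 : Type := Matrix Coord Coord ℚ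

/-! ### Generalized analytic holonomy sets -/

/-- The analytic set `v₁ = v₁(u₁, u₂)`, `v₂ = v₂(u₁, u₂)` in `ℂ⁴`.  Only its germ at the origin is
used. -/
def holonomyGraph (v₁ v₂ : ℂ → ℂ → ℂ) : Set (Coord → ℂ) :=
  {x | x (Sum.inl 1) = v₁ (x (Sum.inl 0)) (x (Sum.inr 0)) ∧
       x (Sum.inr 1) = v₂ (x (Sum.inl 0)) (x (Sum.inr 0))}

/-- The group of the invertible complex linear maps `x ↦ g x` that carry the germ at the origin of
the set `S` onto itself. -/
def germAut (S : Set (Coord → ℂ)) : Subgroup (GL Coord ℂ) where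
  carrier := {g | ∀ᶠ x in 𝓝 (0 : Coord → ℂ), ((g : Matrix Coord Coord ℂ).mulVec x ∈ S ↔ x ∈ S)}
  one_mem' := by simp
  mul_mem' := by
    intro a b ha hb
    simp only [Set.mem_ofPred_eq] at ha hb ⊢
    have ht : Tendsto (fun x : Coord → ℂ => (b : Matrix Coord Coord ℂ).mulVec x) (𝓝 0) (𝓝 0) := by
      have hc : Continuous (fun x : Coord → ℂ => (b : Matrix Coord Coord ℂ).mulVec x) := by
        fun_prop
      simpa using hc.tendsto 0
    filter_upwards [hb, ht.eventually ha] with x h₁ h₂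
    rw [Units.val_mul, ← Matrix.mulVec_mulVec]
    exact h₂.trans h₁
  inv_mem' := by
    intro a ha
    simp only [Set.mem_ofPred_eq] at ha ⊢
    have ht : Tendsto (fun x : Coord → ℂ => ((a⁻¹ : GL Coord ℂ) : Matrix Coord Coord ℂ).mulVec x)
        (𝓝 0) (𝓝 0) := by
      have hc : Continuous
          (fun x : Coord → ℂ => ((a⁻¹ : GL Coord ℂ) : Matrix Coord Coord ℂ).mulVec x) := by
        fun_prop
      simpa using hc.tendsto 0
    filter_upwards [ht.eventually ha] with x h
    rw [Matrix.mulVec_mulVec, ← Units.val_mul, mul_inv_cancel, Units.val_one,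
      Matrix.one_mulVec] at h
    exact h.symm

/-- The rational elements of the automorphism group, `Aut S ∩ GL₄(ℚ)`. -/
noncomputable def rationalGermAut (S : Set (Coord → ℂ)) : Subgroup (GL Coord ℚ) :=
  (germAut S).comap (Matrix.GeneralLinearGroup.map (algebraMap ℚ ℂ))

/-- Near the origin, `v(u₁, u₂) = L(u₁, u₂) + ∑ c_{jk} u₁ʲ u₂ᵏ`, the sum over `j + k ≥ 3` odd. -/
def HasOddExpansion (v L : ℂ → ℂ → ℂ) : Prop :=
  ∃ c : ℕ → ℕ → ℂ, (∀ j k, c j k ≠ 0 → Odd (j + k) ∧ 3 ≤ j + k) ∧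
    ∀ᶠ u : ℂ × ℂ in 𝓝 0,
      HasSum (fun p : ℕ × ℕ => c p.1 p.2 * u.1 ^ p.1 * u.2 ^ p.2) (v u.1 u.2 - L u.1 u.2)

/-- A generalized analytic holonomy set, given by its cusp shapes `τ₁, τ₂` and by the holomorphic
functions `v₁, v₂` near the origin of `ℂ²` that define it. -/
structure GenHolonomySet where
  τ₁ : ℂ
  τ₂ : ℂ
  v₁ : ℂ → ℂ → ℂ
  v₂ : ℂ → ℂ → ℂ
  expansion₁ : HasOddExpansion v₁ (fun u₁ _ => τ₁ * u₁)
  expansion₂ : HasOddExpansion v₂ (fun _ u₂ => τ₂ * u₂)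
  im_pos₁ : 0 < τ₁.im
  im_pos₂ : 0 < τ₂.im
  nonlinear₁ : ¬ ∀ᶠ u₁ : ℂ in 𝓝 0, v₁ u₁ 0 = τ₁ * u₁
  nonlinear₂ : ¬ ∀ᶠ u₂ : ℂ in 𝓝 0, v₂ 0 u₂ = τ₂ * u₂
  even₁ : ∀ᶠ u : ℂ × ℂ in 𝓝 0, v₁ u.1 u.2 = v₁ u.1 (-u.2)
  odd₁ : ∀ᶠ u : ℂ × ℂ in 𝓝 0, v₁ u.1 u.2 = -v₁ (-u.1) u.2
  even₂ : ∀ᶠ u : ℂ × ℂ in 𝓝 0, v₂ u.1 u.2 = v₂ (-u.1) u.2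
  odd₂ : ∀ᶠ u : ℂ × ℂ in 𝓝 0, v₂ u.1 u.2 = -v₂ u.1 (-u.2)
  symmetric : ∃ a : ℂ, ∀ᶠ u : ℂ × ℂ in 𝓝 0,
    deriv (fun y => v₁ u.1 y) u.2 = a * deriv (fun x => v₂ x u.2) u.1
  finite_subgroups : ∀ H : Subgroup (GL Coord ℚ),
    H ≤ rationalGermAut (holonomyGraph v₁ v₂) → Finite H

namespace GenHolonomySet

/-- `Aut 𝒳 ∩ GL₄(ℚ)`. -/
noncomputable def rationalAut (𝒳 : GenHolonomySet) : Subgroup (GL Coord ℚ) :=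
  rationalGermAut (holonomyGraph 𝒳.v₁ 𝒳.v₂)

/-- Both cusp shapes of `𝒳` lie in the subfield `K` of `ℂ`. -/
def CuspShapesIn (𝒳 : GenHolonomySet) (K : IntermediateField ℚ ℂ) : Prop :=
  𝒳.τ₁ ∈ K ∧ 𝒳.τ₂ ∈ K

end GenHolonomySet

/-- The imaginary quadratic field `ℚ(√-d)` inside `ℂ`. -/
noncomputable def imagQuadField (d : ℕ) : IntermediateField ℚ ℂ :=
  IntermediateField.adjoin ℚ {((Real.sqrt d : ℝ) : ℂ) * Complex.I}

/-! ### Types of matrices; the blocks are `A₁ = toBlocks₁₁`, `A₂ = toBlocks₁₂`,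
`A₃ = toBlocks₂₁`, `A₄ = toBlocks₂₂` -/

def IsTypeI (M : Mat4) : Prop :=
  M.toBlocks₁₁.det = 1 ∧ M.toBlocks₂₂.det = 1 ∧ M.toBlocks₁₂ = 0 ∧ M.toBlocks₂₁ = 0

def IsTypeII (M : Mat4) : Prop :=
  M.toBlocks₂₁.det = 1 ∧ M.toBlocks₁₂.det = 1 ∧ M.toBlocks₁₁ = 0 ∧ M.toBlocks₂₂ = 0

def IsTypeIII (M : Mat4) : Prop :=
  (M.toBlocks₁₁.det ≠ 0 ∧ M.toBlocks₁₂.det ≠ 0 ∧ M.toBlocks₂₁.det ≠ 0 ∧ M.toBlocks₂₂.det ≠ 0) ∧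
  M.toBlocks₁₁.det = M.toBlocks₂₂.det ∧
  M.toBlocks₁₂.det = M.toBlocks₂₁.det ∧
  M.toBlocks₁₁.det + M.toBlocks₂₁.det = 1 ∧
  M.toBlocks₁₁.det • (M.toBlocks₁₁⁻¹ * M.toBlocks₁₂) =
    -(M.toBlocks₂₁.det • (M.toBlocks₂₁⁻¹ * M.toBlocks₂₂))

/-- The involution `(u₁, v₁, u₂, v₂) ↦ (u₁, v₁, -u₂, -v₂)`. -/
def iotaMat : Mat4 := Matrix.fromBlocks 1 0 0 (-1)

/-- `A` is a scalar multiple of the identity. -/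
def IsScalarMat (A : Mat2) : Prop := ∃ c : ℚ, A = c • (1 : Mat2)

/-- `M` is the block matrix with rows `(A₁, A₂)` and `(F A₁ A₂, G A₁ A₂)` for some
`A₁, A₂ ∈ GL₂(ℚ)` such that the minimal polynomial of `A₁` is `p`. -/
def HasBlockForm (M : Mat4) (p : ℚ[X]) (F G : Mat2 → Mat2 → Mat2) : Prop :=
  ∃ A₁ A₂ : GL (Fin 2) ℚ, minpoly ℚ (A₁ : Mat2) = p ∧
    M = Matrix.fromBlocks (A₁ : Mat2) (A₂ : Mat2) (F A₁ A₂) (G A₁ A₂)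

/-- `ε` is a sign, `1` or `-1`. -/
def IsSign (ε : ℚ) : Prop := ε = 1 ∨ ε = -1

/-! ### The lists of forms.  In each of the first three, the first conjunct says which cases can
occur and the others give the form of `M` case by case; the signs `ε` in a case are the same. -/

/-- The list for nonscalar `A₁` and cusp shapes in `ℚ(√-3)`. -/
def FormsSqrtNegThree (M : Mat4) : Prop :=
  (minpoly ℚ M = X ^ 2 + 1 ∨
    (minpoly ℚ M = X ^ 4 + X ^ 2 + 1 ∧ IsTypeIII (M ^ 2)) ∨
    (∃ ε, IsSign ε ∧ minpoly ℚ M = X ^ 3 + C ε) ∨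
    (minpoly ℚ M = X ^ 4 + X ^ 2 + 1 ∧ IsTypeI (M ^ 2)) ∨
    (∃ ε, IsSign ε ∧ minpoly ℚ M = X ^ 3 + C (2 * ε) * X ^ 2 + 2 * X + C ε) ∨
    (minpoly ℚ M = X ^ 4 - X ^ 2 + 1 ∧ IsTypeI (M ^ 2))) ∧
  (minpoly ℚ M = X ^ 2 + 1 →
    HasBlockForm M (X ^ 2 + C (3 / 4))
      (fun _ A₂ => -((1 / 4 : ℚ) • A₂⁻¹)) (fun A₁ A₂ => -(A₂⁻¹ * A₁ * A₂))) ∧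
  (minpoly ℚ M = X ^ 4 + X ^ 2 + 1 → IsTypeIII (M ^ 2) →
    HasBlockForm M (X ^ 2 + C (3 / 4))
      (fun _ A₂ => (1 / 4 : ℚ) • A₂⁻¹) (fun A₁ A₂ => A₂⁻¹ * A₁ * A₂)) ∧
  (∀ ε, IsSign ε → minpoly ℚ M = X ^ 3 + C ε →
    HasBlockForm M (X ^ 2 + C (ε / 2) * X + C (1 / 4))
      (fun A₁ A₂ => -((3 : ℚ) • (A₂⁻¹ * A₁ ^ 2))) (fun A₁ A₂ => A₂⁻¹ * A₁ * A₂)) ∧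
  (minpoly ℚ M = X ^ 4 + X ^ 2 + 1 → IsTypeI (M ^ 2) →
    ∃ ε, IsSign ε ∧ HasBlockForm M (X ^ 2 + C (ε / 2) * X + C (1 / 4))
      (fun A₁ A₂ => (3 : ℚ) • (A₂⁻¹ * A₁ ^ 2)) (fun A₁ A₂ => -(A₂⁻¹ * A₁ * A₂))) ∧
  (∀ ε, IsSign ε → minpoly ℚ M = X ^ 3 + C (2 * ε) * X ^ 2 + 2 * X + C ε →
    HasBlockForm M (X ^ 2 + C (3 * ε / 2) * X + C (3 / 4))
      (fun A₁ A₂ => -((1 / 3 : ℚ) • (A₂⁻¹ * A₁ ^ 2))) (fun A₁ A₂ => A₂⁻¹ * A₁ * A₂)) ∧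
  (minpoly ℚ M = X ^ 4 - X ^ 2 + 1 → IsTypeI (M ^ 2) →
    ∃ ε, IsSign ε ∧ HasBlockForm M (X ^ 2 + C (3 * ε / 2) * X + C (3 / 4))
      (fun A₁ A₂ => (1 / 3 : ℚ) • (A₂⁻¹ * A₁ ^ 2)) (fun A₁ A₂ => -(A₂⁻¹ * A₁ * A₂)))

/-- The list for nonscalar `A₁` and cusp shapes in `ℚ(√-2)`. -/
def FormsSqrtNegTwo (M : Mat4) : Prop :=
  (minpoly ℚ M = X ^ 2 + 1 ∨
    (minpoly ℚ M = X ^ 4 + 1 ∧ IsTypeII (M ^ 2)) ∨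
    (∃ ε, IsSign ε ∧ minpoly ℚ M = X ^ 2 + C ε * X + 1) ∨
    (minpoly ℚ M = X ^ 4 + 1 ∧ IsTypeIII (M ^ 2))) ∧
  (minpoly ℚ M = X ^ 2 + 1 →
    HasBlockForm M (X ^ 2 + C (1 / 2))
      (fun _ A₂ => -((1 / 2 : ℚ) • A₂⁻¹)) (fun A₁ A₂ => -(A₂⁻¹ * A₁ * A₂))) ∧
  (minpoly ℚ M = X ^ 4 + 1 → IsTypeII (M ^ 2) →
    HasBlockForm M (X ^ 2 + C (1 / 2))
      (fun _ A₂ => (1 / 2 : ℚ) • A₂⁻¹) (fun A₁ A₂ => A₂⁻¹ * A₁ * A₂)) ∧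
  (∀ ε, IsSign ε → minpoly ℚ M = X ^ 2 + C ε * X + 1 →
    HasBlockForm M (X ^ 2 + C ε * X + C (3 / 4))
      (fun _ A₂ => -((1 / 4 : ℚ) • A₂⁻¹))
      (fun A₁ A₂ => (3 / 4 : ℚ) • (A₂⁻¹ * A₁⁻¹ * A₂))) ∧
  (minpoly ℚ M = X ^ 4 + 1 → IsTypeIII (M ^ 2) →
    ∃ ε, IsSign ε ∧ HasBlockForm M (X ^ 2 + C ε * X + C (3 / 4))
      (fun _ A₂ => (1 / 4 : ℚ) • A₂⁻¹)
      (fun A₁ A₂ => -((3 / 4 : ℚ) • (A₂⁻¹ * A₁⁻¹ * A₂))))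

/-- The list for nonscalar `A₁` and cusp shapes in `ℚ(√-1)`. -/
def FormsSqrtNegOne (M : Mat4) : Prop :=
  (minpoly ℚ M = X ^ 2 + 1 ∨
    (minpoly ℚ M = X ^ 4 - X ^ 2 + 1 ∧ IsTypeIII (M ^ 2) ∧
      minpoly ℚ (iotaMat * M ^ 2) = X ^ 2 - 1) ∨
    (∃ ε, IsSign ε ∧ minpoly ℚ M = X ^ 3 + C ε * X ^ 2 + X + C ε) ∨
    (minpoly ℚ M = X ^ 4 + 1 ∧ IsTypeI (M ^ 2)) ∨
    (∃ ε, IsSign ε ∧ minpoly ℚ M = X ^ 2 + C ε * X + 1) ∨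
    (minpoly ℚ M = X ^ 4 - X ^ 2 + 1 ∧ IsTypeIII (M ^ 2) ∧
      minpoly ℚ (iotaMat * M ^ 2) = X ^ 4 - X ^ 2 + 1)) ∧
  (minpoly ℚ M = X ^ 2 + 1 →
    HasBlockForm M (X ^ 2 + C (1 / 4))
      (fun _ A₂ => -((3 / 4 : ℚ) • A₂⁻¹)) (fun A₁ A₂ => -(A₂⁻¹ * A₁ * A₂))) ∧
  (minpoly ℚ M = X ^ 4 - X ^ 2 + 1 → IsTypeIII (M ^ 2) →
    minpoly ℚ (iotaMat * M ^ 2) = X ^ 2 - 1 →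
    HasBlockForm M (X ^ 2 + C (1 / 4))
      (fun _ A₂ => (3 / 4 : ℚ) • A₂⁻¹) (fun A₁ A₂ => A₂⁻¹ * A₁ * A₂)) ∧
  (∀ ε, IsSign ε → minpoly ℚ M = X ^ 3 + C ε * X ^ 2 + X + C ε →
    HasBlockForm M (X ^ 2 + C ε * X + C (1 / 2))
      (fun A₁ A₂ => -(A₂⁻¹ * A₁ ^ 2)) (fun A₁ A₂ => A₂⁻¹ * A₁ * A₂)) ∧
  (minpoly ℚ M = X ^ 4 + 1 → IsTypeI (M ^ 2) →
    ∃ ε, IsSign ε ∧ HasBlockForm M (X ^ 2 + C ε * X + C (1 / 2))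
      (fun A₁ A₂ => A₂⁻¹ * A₁ ^ 2) (fun A₁ A₂ => -(A₂⁻¹ * A₁ * A₂))) ∧
  (∀ ε, IsSign ε → minpoly ℚ M = X ^ 2 + C ε * X + 1 →
    HasBlockForm M (X ^ 2 + C ε * X + C (1 / 2))
      (fun _ A₂ => -((1 / 2 : ℚ) • A₂⁻¹))
      (fun A₁ A₂ => (1 / 2 : ℚ) • (A₂⁻¹ * A₁⁻¹ * A₂))) ∧
  (minpoly ℚ M = X ^ 4 - X ^ 2 + 1 → IsTypeIII (M ^ 2) →
    minpoly ℚ (iotaMat * M ^ 2) = X ^ 4 - X ^ 2 + 1 →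
    ∃ ε, IsSign ε ∧ HasBlockForm M (X ^ 2 + C ε * X + C (1 / 2))
      (fun _ A₂ => (1 / 2 : ℚ) • A₂⁻¹)
      (fun A₁ A₂ => -((1 / 2 : ℚ) • (A₂⁻¹ * A₁⁻¹ * A₂))))

/-- The list for scalar `A₁`. -/
def FormsScalar (M : Mat4) : Prop :=
  (minpoly ℚ M = X ^ 2 - 1 ∧
    ∃ (ε : ℚ) (A₂ : GL (Fin 2) ℚ), IsSign ε ∧ (A₂ : Mat2).det = 3 / 4 ∧
      M = Matrix.fromBlocks ((ε / 2) • (1 : Mat2)) (A₂ : Mat2)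
        ((3 / 4 : ℚ) • (A₂ : Mat2)⁻¹) (-((ε / 2) • (1 : Mat2)))) ∨
  (minpoly ℚ M = X ^ 2 + X + 1 ∧
    ∃ A₂ : GL (Fin 2) ℚ, (A₂ : Mat2).det = 3 / 4 ∧
      M = Matrix.fromBlocks (-((1 / 2 : ℚ) • (1 : Mat2))) (A₂ : Mat2)
        (-((3 / 4 : ℚ) • (A₂ : Mat2)⁻¹)) (-((1 / 2 : ℚ) • (1 : Mat2)))) ∨
  (minpoly ℚ M = X ^ 2 - X + 1 ∧
    ∃ A₂ : GL (Fin 2) ℚ, (A₂ : Mat2).det = 3 / 4 ∧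
      M = Matrix.fromBlocks ((1 / 2 : ℚ) • (1 : Mat2)) (-(A₂ : Mat2))
        ((3 / 4 : ℚ) • (A₂ : Mat2)⁻¹) ((1 / 2 : ℚ) • (1 : Mat2)))

/-!
The proof only uses the tangent plane of the holonomy germ at the origin and the finiteness of
subgroups of `Aut 𝒳 ∩ GL₄(ℚ)`.

A rational automorphism `M` preserves the tangent plane `{(u₁, τ₁u₁, u₂, τ₂u₂)}`
(`GenHolonomySet.mulVec_tangentVec`), so each of its blocks sends `(1, τ_j)` to a multiple of
`(1, τ_i)`.  As `τ₁, τ₂` are not real, a rational matrix is determined by its multiplier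
(`Acts.unique`), and `M` satisfies the same rational polynomials as the `2 × 2` matrix `m` of
multipliers, whose entries lie in the imaginary quadratic field `K` of the cusp shapes
(`aeval_eq_zero_iff_of_intertwines`).  Type III means that `m` is unitary for a suitable diagonal
hermitian form and has no zero entry (`ActsUnitarily.of_isTypeIII`); it is then determined by
`l₁`, `l₃` and `δ = det m`, with trace `t = l₁ + δ l̄₁`.

The parity conditions make `ι` an automorphism, so both `M` and `ι M ι M⁻¹` have finite order.  The
latter has trace `4|l₁|² - 2` on the tangent plane, a rational algebraic integer in `(-2, 2)`; hence
`|l₁|² = det A₁` is `1/4`, `1/2` or `3/4` (`ActsUnitarily.norm_sq_cases`).  Since `M` has finite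
order, `δ` and `t` are algebraic integers of `K`.  With `|δ| = 1` and `|t|² ≤ 4|l₁|² ≤ 3` this leaves
finitely many pairs `(l₁, δ)` and, unless `l₁` is rational, only the fields `ℚ(√-3)`, `ℚ(√-2)` and
`ℚ(√-1)` (`multiplierCases_of_isIntegral`).  In every case `t` and `δ` give the minimal polynomial of
`M`, and the multipliers `l₃` and `δ l̄₁` give the blocks `A₃` and `A₄`.
-/

open scoped ComplexConjugate

/-! ### The tangent plane of the germ and automorphisms of finite order -/

/-- All terms beyond `L` have degree at least three, so `v - L = O(‖u‖³)` by comparison with the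
absolutely convergent series at a point `(r, r)`. -/
theorem HasOddExpansion.hasFDerivAt {v L : ℂ → ℂ → ℂ} (h : HasOddExpansion v L)
    (L' : ℂ × ℂ →L[ℂ] ℂ) (hL : ∀ u, L' u = L u.1 u.2) :
    HasFDerivAt (fun u : ℂ × ℂ => v u.1 u.2) L' 0 := by
  obtain ⟨c, hc, hs⟩ := h
  obtain ⟨ε, hε, hball⟩ := Metric.eventually_nhds_iff_ball.1 hs
  set r : ℝ := ε / 2 with hr
  have hr0 : 0 < r := by positivity
  have hsum : Summable fun p : ℕ × ℕ => ‖c p.1 p.2‖ * r ^ (p.1 + p.2) := by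
    have h1 := (hball ((r : ℂ), (r : ℂ)) (by
      simp only [Metric.mem_ball, dist_zero_right, Prod.norm_def, Complex.norm_real,
        Real.norm_eq_abs, abs_of_pos hr0, max_self]
      linarith)).summable.norm
    refine h1.congr fun p => ?_
    simp [abs_of_pos hr0, pow_add, mul_assoc]
  have hbig : (fun u : ℂ × ℂ => v u.1 u.2 - L' u) =O[𝓝 0] fun u => ‖u - 0‖ ^ 3 := by
    refine Asymptotics.IsBigO.of_bound
      ((∑' p : ℕ × ℕ, ‖c p.1 p.2‖ * r ^ (p.1 + p.2)) / r ^ 3) ?_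
    filter_upwards [Metric.ball_mem_nhds (0 : ℂ × ℂ) hr0] with u hu
    have hur : ‖u‖ ≤ r := by
      have : ‖u‖ < r := by simpa using hu
      exact this.le
    have hmem : u ∈ Metric.ball (0 : ℂ × ℂ) ε := by
      simp only [Metric.mem_ball, dist_zero_right]
      linarith
    have hsu := hball u hmem
    rw [hL u, ← hsu.tsum_eq]
    have hterm : ∀ p : ℕ × ℕ, ‖c p.1 p.2 * u.1 ^ p.1 * u.2 ^ p.2‖ ≤
        ‖c p.1 p.2‖ * r ^ (p.1 + p.2) * (‖u‖ / r) ^ 3 := by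
      intro p
      by_cases h0 : c p.1 p.2 = 0
      · simp [h0]
      have h3 := (hc _ _ h0).2
      have hq : ‖u‖ / r ≤ 1 := (div_le_one hr0).2 hur
      calc ‖c p.1 p.2 * u.1 ^ p.1 * u.2 ^ p.2‖
          = ‖c p.1 p.2‖ * (‖u.1‖ ^ p.1 * ‖u.2‖ ^ p.2) := by simp [mul_assoc]
        _ ≤ ‖c p.1 p.2‖ * (‖u‖ ^ p.1 * ‖u‖ ^ p.2) := by
            gcongr
            · exact norm_fst_le u
            · exact norm_snd_le u
        _ = ‖c p.1 p.2‖ * r ^ (p.1 + p.2) * (‖u‖ / r) ^ (p.1 + p.2) := by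
            rw [← pow_add, mul_assoc, ← mul_pow, mul_div_cancel₀ _ hr0.ne']
        _ ≤ _ := by
            gcongr ?_ * ?_
            exact pow_le_pow_of_le_one (by positivity) hq h3
    have hb := tsum_of_norm_bounded (hsum.hasSum.mul_right ((‖u‖ / r) ^ 3)) hterm
    refine hb.trans (le_of_eq ?_)
    simp only [sub_zero, norm_pow, norm_norm, div_pow]
    ring
  have hd := (hbig.hasFDerivAt (𝕜 := ℂ) (by norm_num)).add (L'.hasFDerivAt (x := 0))
  rw [zero_add] at hd
  exact hd.congr_of_eventuallyEq (Eventually.of_forall fun u => by simp)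

theorem HasOddExpansion.apply_zero {v L : ℂ → ℂ → ℂ} (h : HasOddExpansion v L) (hL : L 0 0 = 0) :
    v 0 0 = 0 := by
  obtain ⟨c, hc, hs⟩ := h
  have h0 := hs.self_of_nhds
  have hz : (fun p : ℕ × ℕ => c p.1 p.2 * (0 : ℂ × ℂ).1 ^ p.1 * (0 : ℂ × ℂ).2 ^ p.2) = 0 := by
    funext p
    by_cases hcp : c p.1 p.2 = 0
    · simp [hcp]
    have := (hc _ _ hcp).2
    rcases Nat.eq_zero_or_pos p.1 with h1 | h1
    · have h2 : p.2 ≠ 0 := by omega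
      simp [h2]
    · simp [h1.ne']
  rw [hz] at h0
  have := h0.unique hasSum_zero
  simpa [hL] using this

namespace GenHolonomySet

variable (𝒳 : GenHolonomySet)

theorem hasFDerivAt₁ : HasFDerivAt (fun u : ℂ × ℂ => 𝒳.v₁ u.1 u.2)
    (𝒳.τ₁ • ContinuousLinearMap.fst ℂ ℂ ℂ) 0 :=
  𝒳.expansion₁.hasFDerivAt _ fun u => by simp

theorem hasFDerivAt₂ : HasFDerivAt (fun u : ℂ × ℂ => 𝒳.v₂ u.1 u.2)
    (𝒳.τ₂ • ContinuousLinearMap.snd ℂ ℂ ℂ) 0 :=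
  𝒳.expansion₂.hasFDerivAt _ fun u => by simp

/-- The tangent vector at the origin of the holonomy germ that lies above `(a, b)`, in the
coordinates `(u₁, v₁, u₂, v₂)`. -/
def tangentVec (a b : ℂ) : Coord → ℂ := Sum.elim ![a, 𝒳.τ₁ * a] ![b, 𝒳.τ₂ * b]

/-- An automorphism of the germ preserves its tangent plane at the origin: differentiate
`v₁(g x)`, `v₂(g x)` along the curve `x` in the germ above the line through `(a, b)`. -/
theorem mulVec_tangentVec {g : GL Coord ℂ} (hg : g ∈ germAut (holonomyGraph 𝒳.v₁ 𝒳.v₂))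
    (a b : ℂ) :
    ((g : Matrix Coord Coord ℂ).mulVec (𝒳.tangentVec a b)) (Sum.inl 1) =
        𝒳.τ₁ * ((g : Matrix Coord Coord ℂ).mulVec (𝒳.tangentVec a b)) (Sum.inl 0) ∧
      ((g : Matrix Coord Coord ℂ).mulVec (𝒳.tangentVec a b)) (Sum.inr 1) =
        𝒳.τ₂ * ((g : Matrix Coord Coord ℂ).mulVec (𝒳.tangentVec a b)) (Sum.inr 0) := by
  have hv₁0 : 𝒳.v₁ 0 0 = 0 := HasOddExpansion.apply_zero 𝒳.expansion₁ (by simp)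
  have hv₂0 : 𝒳.v₂ 0 0 = 0 := HasOddExpansion.apply_zero 𝒳.expansion₂ (by simp)
  set F : ℂ → Coord → ℂ := fun z =>
    Sum.elim ![z * a, 𝒳.v₁ (z * a) (z * b)] ![z * b, 𝒳.v₂ (z * a) (z * b)] with hF
  have hline : HasDerivAt (fun z : ℂ => (z * a, z * b)) (a, b) 0 := by
    have h1 := (hasDerivAt_id (0 : ℂ)).mul_const a
    have h2 := (hasDerivAt_id (0 : ℂ)).mul_const b
    simpa using h1.prodMk h2
  have hF0 : F 0 = 0 := by
    funext c
    rcases c with c | c <;> fin_cases c <;> simp [hF, hv₁0, hv₂0]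
  have hFd : HasDerivAt F (𝒳.tangentVec a b) 0 := by
    rw [hasDerivAt_pi]
    have h1 := 𝒳.hasFDerivAt₁
    have h2 := 𝒳.hasFDerivAt₂
    have e : ((0 : ℂ) * a, (0 : ℂ) * b) = (0 : ℂ × ℂ) := by simp
    rw [← e] at h1 h2
    have h1 := h1.comp_hasDerivAt (0 : ℂ) hline
    have h2 := h2.comp_hasDerivAt (0 : ℂ) hline
    rintro (c | c) <;> fin_cases c
    · simpa [hF, tangentVec] using (hasDerivAt_id (0 : ℂ)).mul_const a
    · simpa [hF, tangentVec, Function.comp_def] using h1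
    · simpa [hF, tangentVec] using (hasDerivAt_id (0 : ℂ)).mul_const b
    · simpa [hF, tangentVec, Function.comp_def] using h2
  set A : (Coord → ℂ) →L[ℂ] (Coord → ℂ) :=
    LinearMap.toContinuousLinearMap (Matrix.mulVecLin (g : Matrix Coord Coord ℂ)) with hA
  have hAx : ∀ x, A x = (g : Matrix Coord Coord ℂ).mulVec x := fun x => rfl
  have hG : HasDerivAt (fun z => A (F z)) (A (𝒳.tangentVec a b)) 0 :=
    A.hasFDerivAt.comp_hasDerivAt (0 : ℂ) hFd
  have hG' := hasDerivAt_pi.1 hG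
  have hev : ∀ᶠ z in 𝓝 (0 : ℂ), A (F z) ∈ holonomyGraph 𝒳.v₁ 𝒳.v₂ := by
    have ht : Tendsto F (𝓝 0) (𝓝 0) := by
      simpa [hF0] using hFd.continuousAt.tendsto
    filter_upwards [ht.eventually hg] with z hz
    exact hz.2 ⟨by simp [hF], by simp [hF]⟩
  have hpair : HasDerivAt (fun z => (A (F z) (Sum.inl 0), A (F z) (Sum.inr 0)))
      (A (𝒳.tangentVec a b) (Sum.inl 0), A (𝒳.tangentVec a b) (Sum.inr 0)) 0 :=
    (hG' (Sum.inl 0)).prodMk (hG' (Sum.inr 0))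
  have e : (A (F 0) (Sum.inl 0), A (F 0) (Sum.inr 0)) = (0 : ℂ × ℂ) := by simp [hF0]
  have h1 := 𝒳.hasFDerivAt₁
  have h2 := 𝒳.hasFDerivAt₂
  rw [← e] at h1 h2
  have h1 := h1.comp_hasDerivAt (0 : ℂ) hpair
  have h2 := h2.comp_hasDerivAt (0 : ℂ) hpair
  have k1 := (hG' (Sum.inl 1)).unique
    (h1.congr_of_eventuallyEq (by filter_upwards [hev] with z hz using hz.1))
  have k2 := (hG' (Sum.inr 1)).unique
    (h2.congr_of_eventuallyEq (by filter_upwards [hev] with z hz using hz.2))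
  simp only [hAx] at k1 k2
  exact ⟨by simpa using k1, by simpa using k2⟩

/-- `ι` as an element of `GL₄(ℚ)`. -/
def iotaGL : GL Coord ℚ where
  val := iotaMat
  inv := iotaMat
  val_inv := by simp [iotaMat, Matrix.fromBlocks_multiply]
  inv_val := by simp [iotaMat, Matrix.fromBlocks_multiply]

/-- The parity conditions say exactly that `ι` is an automorphism of the germ. -/
theorem iotaGL_mem : iotaGL ∈ 𝒳.rationalAut := by
  change ∀ᶠ x in 𝓝 (0 : Coord → ℂ), _
  have ht : Tendsto (fun x : Coord → ℂ => (x (Sum.inl 0), x (Sum.inr 0))) (𝓝 0) (𝓝 0) := by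
    have hc : Continuous fun x : Coord → ℂ => (x (Sum.inl 0), x (Sum.inr 0)) := by fun_prop
    exact hc.tendsto 0
  filter_upwards [ht.eventually 𝒳.even₁, ht.eventually 𝒳.odd₂] with x h1 h2
  have hx : (((Matrix.GeneralLinearGroup.map (algebraMap ℚ ℂ)) iotaGL : GL Coord ℂ) :
      Matrix Coord Coord ℂ).mulVec x =
      Sum.elim (fun i => x (Sum.inl i)) (fun i => -x (Sum.inr i)) := by
    have : (((Matrix.GeneralLinearGroup.map (algebraMap ℚ ℂ)) iotaGL : GL Coord ℂ) :
      Matrix Coord Coord ℂ) = Matrix.fromBlocks 1 0 0 (-1) := by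
      change iotaMat.map (algebraMap ℚ ℂ) = _
      simp [iotaMat, Matrix.fromBlocks_map, Matrix.map_neg]
    rw [this, Matrix.fromBlocks_mulVec]
    funext c
    rcases c with c | c <;> simp [Matrix.neg_mulVec]
  rw [hx]
  simp only [holonomyGraph, Set.mem_ofPred_eq, Sum.elim_inl, Sum.elim_inr] at h1 h2 ⊢
  rw [← h1]
  have h3 : 𝒳.v₂ (x (Sum.inl 0)) (-x (Sum.inr 0)) = - 𝒳.v₂ (x (Sum.inl 0)) (x (Sum.inr 0)) := by
    rw [h2, neg_neg]
  rw [h3, neg_inj]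

theorem exists_pow_eq_one {g : GL Coord ℚ} (hg : g ∈ 𝒳.rationalAut) :
    ∃ n : ℕ, 0 < n ∧ g ^ n = 1 := by
  have : Finite (Subgroup.zpowers g) :=
    𝒳.finite_subgroups _ (by rwa [Subgroup.zpowers_le])
  exact isOfFinOrder_iff_pow_eq_one.1 (finite_zpowers.1 this)

end GenHolonomySet

/-! ### Rational matrices acting on a vector `(1, σ)` -/

/-- The rational matrix `B` sends the complex vector `(1, σ)` to `l · (1, τ)`.  The number `l` is the
*multiplier* of `B`; for `σ = τ` quadratic, `B ↦ l` is the regular representation of `ℚ(σ)`. -/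
def Acts (B : Mat2) (σ τ l : ℂ) : Prop :=
  (B.map (algebraMap ℚ ℂ)).mulVec ![1, σ] = l • ![1, τ]

theorem acts_iff {B : Mat2} {σ τ l : ℂ} :
    Acts B σ τ l ↔ (B 0 0 : ℂ) + B 0 1 * σ = l ∧ (B 1 0 : ℂ) + B 1 1 * σ = l * τ := by
  unfold Acts
  rw [funext_iff, Fin.forall_fin_two]
  simp [Matrix.mulVec, dotProduct, Fin.sum_univ_two]

/-- A non-real number is linearly independent of `1` over `ℚ`. -/
theorem rat_add_rat_mul_eq_zero {σ : ℂ} (hσ : σ.im ≠ 0) {a b : ℚ} (h : (a : ℂ) + b * σ = 0) :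
    a = 0 ∧ b = 0 := by
  have h1 := congrArg Complex.im h
  simp [hσ] at h1
  subst h1
  simpa using h

namespace Acts

variable {B B' : Mat2} {ρ σ τ l l' : ℂ}

theorem congr (h : Acts B σ τ l) (e : l = l') : Acts B σ τ l' := e ▸ h

theorem one : Acts 1 σ σ 1 := by simp [acts_iff]

theorem add (h : Acts B σ τ l) (h' : Acts B' σ τ l') : Acts (B + B') σ τ (l + l') := by
  rw [acts_iff] at *
  simp only [Matrix.add_apply, Rat.cast_add]
  constructor
  · linear_combination h.1 + h'.1
  · linear_combination h.2 + h'.2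

theorem neg (h : Acts B σ τ l) : Acts (-B) σ τ (-l) := by
  rw [acts_iff] at *
  simp only [Matrix.neg_apply, Rat.cast_neg]
  constructor
  · linear_combination -h.1
  · linear_combination -h.2

theorem smul (h : Acts B σ τ l) (c : ℚ) : Acts (c • B) σ τ (c * l) := by
  rw [acts_iff] at *
  simp only [Matrix.smul_apply, smul_eq_mul, Rat.cast_mul]
  constructor
  · linear_combination (c : ℂ) * h.1
  · linear_combination (c : ℂ) * h.2

theorem mul (h : Acts B σ τ l) (h' : Acts B' ρ σ l') : Acts (B * B') ρ τ (l * l') := by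
  unfold Acts at *
  rw [Matrix.map_mul, ← Matrix.mulVec_mulVec, h', Matrix.mulVec_smul, h, smul_smul, mul_comm]

theorem pow (h : Acts B σ σ l) (n : ℕ) : Acts (B ^ n) σ σ (l ^ n) := by
  induction n with
  | zero => simpa using one
  | succ n ih => rw [pow_succ, pow_succ]; exact ih.mul h

/-- A rational matrix is determined by its multiplier, because `1` and `σ ∉ ℝ` are independent
over `ℚ`. -/
theorem unique (hσ : σ.im ≠ 0) (h : Acts B σ τ l) (h' : Acts B' σ τ l) : B = B' := by
  rw [acts_iff] at h h'
  have h0 := rat_add_rat_mul_eq_zero hσ (a := B 0 0 - B' 0 0) (b := B 0 1 - B' 0 1)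
    (by push_cast; linear_combination h.1 - h'.1)
  have h1 := rat_add_rat_mul_eq_zero hσ (a := B 1 0 - B' 1 0) (b := B 1 1 - B' 1 1)
    (by push_cast; linear_combination h.2 - h'.2)
  ext i j
  fin_cases i <;> fin_cases j
  · exact sub_eq_zero.1 h0.1
  · exact sub_eq_zero.1 h0.2
  · exact sub_eq_zero.1 h1.1
  · exact sub_eq_zero.1 h1.2

theorem zero : Acts 0 σ τ 0 := by simp [acts_iff]

/-- The determinant of `B` is the square of the absolute value of its multiplier, up to the ratio
of the imaginary parts. -/
theorem det_mul_im (h : Acts B σ τ l) : (B.det : ℝ) * σ.im = Complex.normSq l * τ.im := by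
  rw [acts_iff] at h
  obtain ⟨h0, h1⟩ := h
  have g0 := congrArg conj h0
  have g1 := congrArg conj h1
  simp only [map_add, map_mul, map_ratCast] at g0 g1
  have hσ := Complex.sub_conj σ
  have hτ := Complex.sub_conj τ
  have hl := Complex.mul_conj l
  have key : (B.det : ℂ) * (σ - conj σ) = (l * conj l) * (τ - conj τ) := by
    rw [Matrix.det_fin_two]
    push_cast
    linear_combination ((B 1 0 : ℂ) + B 1 1 * σ) * g0 + conj l * h1
      - ((B 1 0 : ℂ) + B 1 1 * conj σ) * h0 - l * g1
  rw [hσ, hτ, hl] at key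
  generalize B.det = d at key ⊢
  have k2 : ((2 * ((d : ℝ) * σ.im) : ℝ) : ℂ) * Complex.I =
      ((2 * (Complex.normSq l * τ.im) : ℝ) : ℂ) * Complex.I := by
    push_cast at key ⊢
    linear_combination key
  have k3 := Complex.ofReal_injective (mul_right_cancel₀ Complex.I_ne_zero k2)
  linarith

theorem inv (h : Acts B σ τ l) (hB : B.det ≠ 0) (hl : l ≠ 0) : Acts B⁻¹ τ σ l⁻¹ := by
  have e : B⁻¹ * B = 1 := Matrix.nonsing_inv_mul _ (isUnit_iff_ne_zero.2 hB)
  unfold Acts at *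
  have h2 : (B⁻¹.map (algebraMap ℚ ℂ)).mulVec ((B.map (algebraMap ℚ ℂ)).mulVec ![1, σ]) =
      ![1, σ] := by
    rw [Matrix.mulVec_mulVec, ← Matrix.map_mul, e]
    simp
  rw [h, Matrix.mulVec_smul] at h2
  rw [← h2, smul_smul, inv_mul_cancel₀ hl, one_smul]

theorem aeval (h : Acts B σ σ l) (q : ℚ[X]) :
    Acts (Polynomial.aeval B q) σ σ (Polynomial.aeval l q) := by
  induction q using Polynomial.induction_on' with
  | add p q hp hq => rw [map_add, map_add]; exact hp.add hq
  | monomial n a =>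
    rw [aeval_monomial, aeval_monomial, ← Algebra.smul_def]
    exact (h.pow n).smul a

theorem minpoly_eq (h : Acts B σ σ l) (hσ : σ.im ≠ 0) (hl : l.im ≠ 0) {a b : ℚ}
    (e : l ^ 2 + a * l + b = 0) : minpoly ℚ B = X ^ 2 + C a * X + C b := by
  have hdeg : (X ^ 2 + C a * X + C b : ℚ[X]).degree = 2 := by compute_degree!
  refine (minpoly.unique' ℚ B (by monicity!) ?_ ?_).symm
  · refine (h.aeval _).unique hσ (Acts.zero.congr ?_)
    simpa using e.symm
  · intro q hq
    rw [hdeg] at hq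
    rw [or_iff_not_imp_right, not_not]
    intro h0
    have hq' : q.natDegree < 2 := by
      by_cases hq0 : q = 0
      · simp [hq0]
      · exact (natDegree_lt_iff_degree_lt hq0).2 hq
    have h1 := h.aeval q
    rw [h0] at h1
    have h2 : Polynomial.aeval l q = 0 := by
      rw [acts_iff] at h1
      simpa using h1.1.symm
    rw [aeval_eq_sum_range' hq'] at h2
    simp only [Finset.sum_range_succ, Finset.sum_range_zero, Algebra.smul_def] at h2
    have h3 := rat_add_rat_mul_eq_zero hl (a := q.coeff 0) (b := q.coeff 1) (by simpa using h2)
    rw [q.as_sum_range' 2 hq']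
    simp [Finset.sum_range_succ, h3]

end Acts

/-! ### Polynomial identities on the tangent plane -/

/-- The basis `(1, τ₁, 0, 0)`, `(0, 0, 1, τ₂)` of the tangent plane, as the columns of a matrix `P`.
A `4 × 4` matrix `M` acts on the plane through the `2 × 2` matrix `m` when `M P = P m`. -/
def tangentBasis (τ₁ τ₂ : ℂ) : Matrix Coord (Fin 2) ℂ :=
  Matrix.fromRows !![1, 0; τ₁, 0] !![0, 1; 0, τ₂]

theorem aeval_mul_of_intertwines {n k : Type*} [Fintype n] [DecidableEq n] [Fintype k]
    [DecidableEq k] {N : Matrix n n ℂ} {m : Matrix k k ℂ} {P : Matrix n k ℂ}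
    (h : N * P = P * m) (q : ℚ[X]) : aeval N q * P = P * aeval m q := by
  have hp : ∀ i : ℕ, N ^ i * P = P * m ^ i := by
    intro i
    induction i with
    | zero => simp
    | succ i ih => rw [pow_succ, Matrix.mul_assoc, h, ← Matrix.mul_assoc, ih, Matrix.mul_assoc,
        ← pow_succ]
  induction q using Polynomial.induction_on' with
  | add p q hp hq => rw [map_add, map_add, Matrix.add_mul, hp, hq, Matrix.mul_add]
  | monomial i a =>
    rw [aeval_monomial, aeval_monomial, ← Algebra.smul_def, ← Algebra.smul_def, Matrix.smul_mul,
      Matrix.mul_smul, hp]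

/-- A rational matrix that vanishes on the tangent plane is zero, since `τ₁, τ₂` are not real.  So `M`
and its restriction `m` to the plane satisfy the same rational polynomials. -/
theorem aeval_eq_zero_iff_of_intertwines {τ₁ τ₂ : ℂ} (h₁ : τ₁.im ≠ 0) (h₂ : τ₂.im ≠ 0) {M : Mat4}
    {m : Matrix (Fin 2) (Fin 2) ℂ}
    (h : M.map (algebraMap ℚ ℂ) * tangentBasis τ₁ τ₂ = tangentBasis τ₁ τ₂ * m) (q : ℚ[X]) :
    aeval M q = 0 ↔ aeval m q = 0 := by
  have h' := aeval_mul_of_intertwines h q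
  have hmap : aeval (M.map (algebraMap ℚ ℂ)) q = (aeval M q).map (algebraMap ℚ ℂ) :=
    aeval_algHom_apply (Algebra.ofId ℚ ℂ).mapMatrix M q
  rw [hmap] at h'
  constructor
  · intro h0
    rw [h0, Matrix.map_zero _ (map_zero _), Matrix.zero_mul] at h'
    ext i j
    fin_cases i
    · have := congrFun₂ h' (Sum.inl 0) j
      simpa [tangentBasis, Matrix.mul_apply, Fin.sum_univ_two] using this.symm
    · have := congrFun₂ h' (Sum.inr 0) j
      simpa [tangentBasis, Matrix.mul_apply, Fin.sum_univ_two] using this.symm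
  · intro h0
    rw [h0, Matrix.mul_zero] at h'
    have key : ∀ c, aeval M q c (Sum.inl 0) = 0 ∧ aeval M q c (Sum.inl 1) = 0 ∧
        aeval M q c (Sum.inr 0) = 0 ∧ aeval M q c (Sum.inr 1) = 0 := by
      intro c
      have e0 := congrFun₂ h' c 0
      have e1 := congrFun₂ h' c 1
      simp [tangentBasis, Matrix.mul_apply, Fintype.sum_sum_type, Fin.sum_univ_two] at e0 e1
      have k0 := rat_add_rat_mul_eq_zero h₁ e0
      have k1 := rat_add_rat_mul_eq_zero h₂ e1
      exact ⟨k0.1, k0.2, k1.1, k1.2⟩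
    ext c d
    have := key c
    rcases d with d | d <;> fin_cases d <;> simp_all

/-- For non-scalar `m` with characteristic polynomial `X² - tX + δ`, `q(m) = 0` means that the
remainder of `q` modulo this polynomial, here written out for degree at most four, is zero. -/
theorem aeval_fin_two_eq_zero_iff (m : Matrix (Fin 2) (Fin 2) ℂ) (hm : m 1 0 ≠ 0) {t δ : ℂ}
    (ht : m.trace = t) (hδ : m.det = δ) {q : ℚ[X]} (hq : q.natDegree < 5) :
    aeval m q = 0 ↔
      (q.coeff 1 + q.coeff 2 * t + q.coeff 3 * (t ^ 2 - δ) +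
          q.coeff 4 * (t ^ 3 - 2 * t * δ) : ℂ) = 0 ∧
        (q.coeff 0 - q.coeff 2 * δ - q.coeff 3 * (t * δ) -
          q.coeff 4 * (t ^ 2 * δ - δ ^ 2) : ℂ) = 0 := by
  have h2 : m ^ 2 = t • m - δ • 1 := by
    have h := Matrix.aeval_self_charpoly m
    rw [Matrix.charpoly_fin_two, ht, hδ] at h
    simp only [map_add, map_sub, map_mul, aeval_C, map_pow, aeval_X,
      Algebra.algebraMap_eq_smul_one] at h
    rw [smul_mul_assoc, one_mul] at h
    have := eq_neg_of_add_eq_zero_left h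
    rw [sub_eq_iff_eq_add] at this
    rw [this]; abel
  have h3 : m ^ 3 = (t ^ 2 - δ) • m - (t * δ) • 1 := by
    rw [pow_succ, h2, sub_mul, smul_mul_assoc, ← sq, h2, smul_mul_assoc, one_mul]
    module
  have h4 : m ^ 4 = (t ^ 3 - 2 * t * δ) • m - (t ^ 2 * δ - δ ^ 2) • 1 := by
    rw [pow_succ, h3, sub_mul, smul_mul_assoc, ← sq, h2, smul_mul_assoc, one_mul]
    module
  set α : ℂ := q.coeff 1 + q.coeff 2 * t + q.coeff 3 * (t ^ 2 - δ) +
          q.coeff 4 * (t ^ 3 - 2 * t * δ) with hα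
  set β : ℂ := q.coeff 0 - q.coeff 2 * δ - q.coeff 3 * (t * δ) -
          q.coeff 4 * (t ^ 2 * δ - δ ^ 2) with hβ
  have hr : ∀ (a : ℚ) (N : Matrix (Fin 2) (Fin 2) ℂ), a • N = (a : ℂ) • N := by
    intro a N
    ext i j
    simp [Rat.smul_def]
  have e : aeval m q = α • m + β • 1 := by
    rw [aeval_eq_sum_range' hq]
    simp only [Finset.sum_range_succ, Finset.sum_range_zero, h2, h3, h4, pow_zero, pow_one, hr]
    rw [hα, hβ]
    module
  rw [e]
  constructor
  · intro h
    have h10 := congrFun₂ h 1 0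
    simp [hm] at h10
    have h00 := congrFun₂ h 0 0
    simp [h10] at h00
    exact ⟨h10, h00⟩
  · rintro ⟨h, h'⟩
    simp [h, h']

/-! ### Unitary action on the tangent plane -/

/-- The matrix `M` acts on the tangent plane through
`m = [[l₁, -s δ l̄₃], [l₃, δ l̄₁]]` with `s = Im τ₂ / Im τ₁`, `|δ| = 1` and `|l₁|² + s |l₃|² = 1`.
Such an `m` has determinant `δ`, and `diag(1, √s) m diag(1, √s)⁻¹` is the general unitary matrix. -/
structure ActsUnitarily (τ₁ τ₂ : ℂ) (M : Mat4) (l₁ l₃ δ : ℂ) : Prop where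
  acts₁₁ : Acts M.toBlocks₁₁ τ₁ τ₁ l₁
  acts₁₂ : Acts M.toBlocks₁₂ τ₂ τ₁ (-((τ₂.im / τ₁.im : ℝ) * δ * conj l₃))
  acts₂₁ : Acts M.toBlocks₂₁ τ₁ τ₂ l₃
  acts₂₂ : Acts M.toBlocks₂₂ τ₂ τ₂ (δ * conj l₁)
  norm_det : δ * conj δ = 1
  norm_col : l₁ * conj l₁ + (τ₂.im / τ₁.im : ℝ) * (l₃ * conj l₃) = 1

theorem Acts.eq_multiplier {B : Mat2} {σ τ l l' : ℂ} (h : Acts B σ τ l) (h' : Acts B σ τ l') :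
    l = l' := by
  rw [acts_iff] at h h'
  exact h.1.symm.trans h'.1

/-- The formula `det B = |l|² Im τ / Im σ`. -/
theorem Acts.conj_mul {B : Mat2} {σ τ l : ℂ} (h : Acts B σ τ l) (hσ : σ.im ≠ 0) :
    (τ.im / σ.im : ℝ) * (l * conj l) = B.det := by
  have h1 := h.det_mul_im
  have h2 : (B.det : ℝ) = τ.im / σ.im * Complex.normSq l := by
    field_simp
    linarith
  have h3 := congrArg Complex.ofReal h2
  rw [Complex.ofReal_mul, ← Complex.mul_conj] at h3
  rw [← h3, Complex.ofReal_ratCast]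

/-- The conditions on the blocks of a Type III matrix say that its action on the tangent plane is
unitary with no zero entry. -/
theorem ActsUnitarily.of_isTypeIII {τ₁ τ₂ l₁ l₂ l₃ l₄ : ℂ} {M : Mat4} (h₁ : τ₁.im ≠ 0)
    (h₂ : τ₂.im ≠ 0) (h₁₁ : Acts M.toBlocks₁₁ τ₁ τ₁ l₁) (h₁₂ : Acts M.toBlocks₁₂ τ₂ τ₁ l₂)
    (h₂₁ : Acts M.toBlocks₂₁ τ₁ τ₂ l₃) (h₂₂ : Acts M.toBlocks₂₂ τ₂ τ₂ l₄) (hM : IsTypeIII M) :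
    ActsUnitarily τ₁ τ₂ M l₁ l₃ (l₁ * l₄ - l₂ * l₃) ∧ l₁ ≠ 0 ∧ l₃ ≠ 0 := by
  obtain ⟨⟨d1, d2, d3, d4⟩, e14, -, e13, e⟩ := hM
  have n1 := h₁₁.conj_mul h₁
  have n3 := h₂₁.conj_mul h₁
  have n4 := h₂₂.conj_mul h₂
  rw [div_self h₁, Complex.ofReal_one, one_mul] at n1
  rw [div_self h₂, Complex.ofReal_one, one_mul, ← e14] at n4
  have z1 : l₁ ≠ 0 := by
    rintro rfl
    simp at n1
    exact d1 (by exact_mod_cast n1.symm)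
  have z3 : l₃ ≠ 0 := by
    rintro rfl
    simp at n3
    exact d3 (by exact_mod_cast n3.symm)
  have e13' : ((M.toBlocks₁₁.det : ℚ) : ℂ) + (M.toBlocks₂₁.det : ℚ) = 1 := by exact_mod_cast e13
  have a1 := ((h₁₁.inv d1 z1).mul h₁₂).smul M.toBlocks₁₁.det
  have a2 := (((h₂₁.inv d3 z3).mul h₂₂).smul M.toBlocks₂₁.det).neg
  rw [e] at a1
  have k := a1.eq_multiplier a2
  have d1' : ((M.toBlocks₁₁.det : ℚ) : ℂ) ≠ 0 := by exact_mod_cast d1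
  generalize ((M.toBlocks₁₁.det : ℚ) : ℂ) = p at *
  generalize ((M.toBlocks₂₁.det : ℚ) : ℂ) = r at *
  generalize hs : ((τ₂.im / τ₁.im : ℝ) : ℂ) = s at *
  have k' : conj l₁ * l₂ = -(s * conj l₃ * l₄) := by
    rw [← n1, ← n3] at k
    field_simp at k
    linear_combination k
  have hl4 : (l₁ * l₄ - l₂ * l₃) * conj l₁ = l₄ := by
    linear_combination l₄ * e13' + l₄ * n1 - l₃ * k' + l₄ * n3
  have hl2 : -(s * (l₁ * l₄ - l₂ * l₃) * conj l₃) = l₂ := by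
    linear_combination l₂ * e13' + l₂ * n1 + l₂ * n3 - l₁ * k'
  refine ⟨⟨h₁₁, by rw [hs, hl2]; exact h₁₂, h₂₁, by rw [hl4]; exact h₂₂, ?_, ?_⟩, z1, z3⟩
  · have hc := congrArg conj hl4
    rw [map_mul, Complex.conj_conj] at hc
    generalize l₁ * l₄ - l₂ * l₃ = δ at *
    rw [← hl4, map_mul, Complex.conj_conj] at n4
    apply mul_right_cancel₀ d1'
    linear_combination n4 - (δ * conj δ) * n1
  · rw [hs]
    linear_combination n1 + n3 + e13'

theorem natDegree_palindromic (a : ℚ) : (X ^ 4 + C a * X ^ 2 + 1 : ℚ[X]).natDegree = 4 := by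
  compute_degree!

namespace ActsUnitarily

variable {τ₁ τ₂ l₁ l₃ δ : ℂ} {M : Mat4}

theorem iota_mul (h : ActsUnitarily τ₁ τ₂ M l₁ l₃ δ) :
    ActsUnitarily τ₁ τ₂ (iotaMat * M) l₁ (-l₃) (-δ) := by
  have e : iotaMat * M =
      Matrix.fromBlocks M.toBlocks₁₁ M.toBlocks₁₂ (-M.toBlocks₂₁) (-M.toBlocks₂₂) := by
    conv_lhs => rw [← M.fromBlocks_toBlocks]
    rw [iotaMat, Matrix.fromBlocks_multiply]
    simp
  rw [e]
  refine ⟨by simpa using h.acts₁₁, ?_, by simpa using h.acts₂₁.neg, ?_, ?_, ?_⟩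
  · rw [Matrix.toBlocks_fromBlocks₁₂]
    exact h.acts₁₂.congr (by rw [map_neg]; ring)
  · rw [Matrix.toBlocks_fromBlocks₂₂]
    exact h.acts₂₂.neg.congr (by ring)
  · simpa using h.norm_det
  · simpa using h.norm_col

/-- The square of a matrix with trace `t` and determinant `δ` is `t m - δ`, and `δ t̄ = t` by
unitarity. -/
theorem sq (h : ActsUnitarily τ₁ τ₂ M l₁ l₃ δ) :
    ActsUnitarily τ₁ τ₂ (M ^ 2) ((l₁ + δ * conj l₁) * l₁ - δ) ((l₁ + δ * conj l₁) * l₃)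
      (δ ^ 2) := by
  have e : M ^ 2 = Matrix.fromBlocks
      (M.toBlocks₁₁ * M.toBlocks₁₁ + M.toBlocks₁₂ * M.toBlocks₂₁)
      (M.toBlocks₁₁ * M.toBlocks₁₂ + M.toBlocks₁₂ * M.toBlocks₂₂)
      (M.toBlocks₂₁ * M.toBlocks₁₁ + M.toBlocks₂₂ * M.toBlocks₂₁)
      (M.toBlocks₂₁ * M.toBlocks₁₂ + M.toBlocks₂₂ * M.toBlocks₂₂) := by
    conv_lhs => rw [← M.fromBlocks_toBlocks, _root_.sq, Matrix.fromBlocks_multiply]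
  obtain ⟨a, b, c, d, hd, hn⟩ := h
  rw [e]
  refine ⟨?_, ?_, ?_, ?_, ?_, ?_⟩
  · rw [Matrix.toBlocks_fromBlocks₁₁]
    exact ((a.mul a).add (b.mul c)).congr (by linear_combination (-δ) * hn)
  · rw [Matrix.toBlocks_fromBlocks₁₂]
    refine ((a.mul b).add (b.mul d)).congr ?_
    simp only [map_mul, map_add, Complex.conj_conj]
    generalize ((τ₂.im / τ₁.im : ℝ) : ℂ) = s at *
    linear_combination (s * δ * l₁ * conj l₃) * hd
  · rw [Matrix.toBlocks_fromBlocks₂₁]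
    exact ((c.mul a).add (d.mul c)).congr (by ring)
  · rw [Matrix.toBlocks_fromBlocks₂₂]
    refine ((c.mul b).add (d.mul d)).congr ?_
    simp only [map_mul, map_add, map_sub, Complex.conj_conj]
    generalize ((τ₂.im / τ₁.im : ℝ) : ℂ) = s at *
    linear_combination (-δ) * hn + (δ - δ * l₁ * conj l₁) * hd
  · simp only [map_pow]
    linear_combination (δ * conj δ + 1) * hd
  · simp only [map_mul, map_add, map_sub, Complex.conj_conj]
    generalize ((τ₂.im / τ₁.im : ℝ) : ℂ) = s at *
    linear_combination ((l₁ + δ * conj l₁) * (conj l₁ + conj δ * l₁)) * hn +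
      (1 - l₁ * conj l₁) * hd

theorem det₁₁ (h : ActsUnitarily τ₁ τ₂ M l₁ l₃ δ) (h₁ : τ₁.im ≠ 0) :
    (M.toBlocks₁₁.det : ℂ) = l₁ * conj l₁ := by
  simpa [div_self h₁] using (h.acts₁₁.conj_mul h₁).symm

theorem det₂₂ (h : ActsUnitarily τ₁ τ₂ M l₁ l₃ δ) (h₂ : τ₂.im ≠ 0) :
    (M.toBlocks₂₂.det : ℂ) = l₁ * conj l₁ := by
  have := (h.acts₂₂.conj_mul h₂).symm
  rw [div_self h₂, Complex.ofReal_one, one_mul, map_mul, Complex.conj_conj] at this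
  linear_combination this + (l₁ * conj l₁) * h.norm_det

theorem det₂₁ (h : ActsUnitarily τ₁ τ₂ M l₁ l₃ δ) (h₁ : τ₁.im ≠ 0) :
    (M.toBlocks₂₁.det : ℂ) = 1 - l₁ * conj l₁ := by
  linear_combination -(h.acts₂₁.conj_mul h₁) + h.norm_col

theorem det₁₂ (h : ActsUnitarily τ₁ τ₂ M l₁ l₃ δ) (h₁ : τ₁.im ≠ 0) (h₂ : τ₂.im ≠ 0) :
    (M.toBlocks₁₂.det : ℂ) = 1 - l₁ * conj l₁ := by
  have h3 := (h.acts₁₂.conj_mul h₂).symm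
  simp only [map_neg, map_mul, Complex.conj_conj, Complex.conj_ofReal] at h3
  have hs : ((τ₁.im / τ₂.im : ℝ) : ℂ) * ((τ₂.im / τ₁.im : ℝ) : ℂ) = 1 := by
    rw [← Complex.ofReal_mul]
    field_simp
    simp
  have hn := h.norm_col
  have hd := h.norm_det
  generalize ((τ₂.im / τ₁.im : ℝ) : ℂ) = s at *
  generalize ((τ₁.im / τ₂.im : ℝ) : ℂ) = s' at *
  linear_combination h3 + hn + (s * δ * conj δ * l₃ * conj l₃) * hs + (s * l₃ * conj l₃) * hd

theorem isTypeI (h : ActsUnitarily τ₁ τ₂ M l₁ 0 δ) (h₁ : τ₁.im ≠ 0) (h₂ : τ₂.im ≠ 0) :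
    IsTypeI M := by
  have hn : l₁ * conj l₁ = 1 := by simpa using h.norm_col
  refine ⟨?_, ?_, ?_, ?_⟩
  · exact_mod_cast (h.det₁₁ h₁).trans hn
  · exact_mod_cast (h.det₂₂ h₂).trans hn
  · exact (h.acts₁₂.congr (by simp)).unique h₂ Acts.zero
  · exact h.acts₂₁.unique h₁ Acts.zero

theorem isTypeII (h : ActsUnitarily τ₁ τ₂ M 0 l₃ δ) (h₁ : τ₁.im ≠ 0) (h₂ : τ₂.im ≠ 0) :
    IsTypeII M := by
  refine ⟨?_, ?_, ?_, ?_⟩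
  · have := h.det₂₁ h₁
    simp at this
    exact_mod_cast this
  · have := h.det₁₂ h₁ h₂
    simp at this
    exact_mod_cast this
  · exact h.acts₁₁.unique h₁ Acts.zero
  · exact (h.acts₂₂.congr (by simp)).unique h₂ Acts.zero

theorem isTypeIII (h : ActsUnitarily τ₁ τ₂ M l₁ l₃ δ) (h₁ : τ₁.im ≠ 0) (h₂ : τ₂.im ≠ 0)
    (hl₁ : l₁ ≠ 0) (hl₃ : l₃ ≠ 0) : IsTypeIII M := by
  have e1 := h.det₁₁ h₁
  have e2 := h.det₁₂ h₁ h₂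
  have e3 := h.det₂₁ h₁
  have e4 := h.det₂₂ h₂
  have hs : ((τ₂.im / τ₁.im : ℝ) : ℂ) ≠ 0 := by
    simpa using div_ne_zero h₂ h₁
  have n1 : l₁ * conj l₁ ≠ 0 := mul_ne_zero hl₁ (by simpa using hl₁)
  have n3 : 1 - l₁ * conj l₁ ≠ 0 := by
    rw [← h.norm_col, add_sub_cancel_left]
    exact mul_ne_zero hs (mul_ne_zero hl₃ (by simpa using hl₃))
  have d1 : M.toBlocks₁₁.det ≠ 0 := by
    rw [← e1] at n1; exact_mod_cast n1
  have d3 : M.toBlocks₂₁.det ≠ 0 := by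
    rw [← e3] at n3; exact_mod_cast n3
  have e14 : M.toBlocks₁₁.det = M.toBlocks₂₂.det := by exact_mod_cast e1.trans e4.symm
  have e23 : M.toBlocks₁₂.det = M.toBlocks₂₁.det := by exact_mod_cast e2.trans e3.symm
  refine ⟨⟨d1, e23 ▸ d3, d3, e14 ▸ d1⟩, e14, e23, ?_, ?_⟩
  · have : (M.toBlocks₁₁.det : ℂ) + M.toBlocks₂₁.det = 1 := by rw [e1, e3]; ring
    exact_mod_cast this
  · refine Acts.unique h₂ (((h.acts₁₁.inv d1 hl₁).mul h.acts₁₂).smul _)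
      ((((h.acts₂₁.inv d3 hl₃).mul h.acts₂₂).smul _).neg.congr ?_)
    rw [e1, e3, ← h.norm_col]
    field_simp
    ring

theorem intertwines (h : ActsUnitarily τ₁ τ₂ M l₁ l₃ δ) :
    M.map (algebraMap ℚ ℂ) * tangentBasis τ₁ τ₂ = tangentBasis τ₁ τ₂ *
      !![l₁, -((τ₂.im / τ₁.im : ℝ) * δ * conj l₃); l₃, δ * conj l₁] := by
  obtain ⟨a, b, c, d, -, -⟩ := h
  rw [acts_iff] at a b c d
  generalize ((τ₂.im / τ₁.im : ℝ) : ℂ) = s at *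
  simp only [Matrix.toBlocks₁₁, Matrix.toBlocks₁₂, Matrix.toBlocks₂₁, Matrix.toBlocks₂₂,
    Matrix.of_apply] at a b c d
  ext i j
  rcases i with i | i <;> fin_cases i <;> fin_cases j <;>
    simp [tangentBasis, Matrix.mul_apply, Fintype.sum_sum_type, Fin.sum_univ_two]
  · exact a.1
  · linear_combination b.1
  · linear_combination a.2
  · linear_combination b.2
  · exact c.1
  · exact d.1
  · linear_combination c.2
  · linear_combination d.2

theorem aeval_eq_zero_iff (h : ActsUnitarily τ₁ τ₂ M l₁ l₃ δ) (h₁ : τ₁.im ≠ 0) (h₂ : τ₂.im ≠ 0)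
    (hl₃ : l₃ ≠ 0) {t : ℂ} (ht : l₁ + δ * conj l₁ = t) {q : ℚ[X]} (hq : q.natDegree < 5) :
    aeval M q = 0 ↔
      (q.coeff 1 + q.coeff 2 * t + q.coeff 3 * (t ^ 2 - δ) +
          q.coeff 4 * (t ^ 3 - 2 * t * δ) : ℂ) = 0 ∧
        (q.coeff 0 - q.coeff 2 * δ - q.coeff 3 * (t * δ) -
          q.coeff 4 * (t ^ 2 * δ - δ ^ 2) : ℂ) = 0 := by
  rw [aeval_eq_zero_iff_of_intertwines h₁ h₂ h.intertwines,
    aeval_fin_two_eq_zero_iff _ (by simpa using hl₃) _ _ hq]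
  · simpa [Matrix.trace_fin_two] using ht
  · rw [Matrix.det_fin_two_of]
    linear_combination δ * h.norm_col

/-- Criterion for `f`, of degree at most four, to be the minimal polynomial of `M`: it has remainder
zero modulo `X² - tX + δ`, and no nonzero rational polynomial of smaller degree has. -/
theorem minpoly_eq (h : ActsUnitarily τ₁ τ₂ M l₁ l₃ δ) (h₁ : τ₁.im ≠ 0) (h₂ : τ₂.im ≠ 0)
    (hl₃ : l₃ ≠ 0) {t : ℂ} (ht : l₁ + δ * conj l₁ = t) {f : ℚ[X]} (hf : f.Monic)
    (hdeg : f.natDegree < 5)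
    (hf1 : (f.coeff 1 + f.coeff 2 * t + f.coeff 3 * (t ^ 2 - δ) +
          f.coeff 4 * (t ^ 3 - 2 * t * δ) : ℂ) = 0)
    (hf0 : (f.coeff 0 - f.coeff 2 * δ - f.coeff 3 * (t * δ) -
          f.coeff 4 * (t ^ 2 * δ - δ ^ 2) : ℂ) = 0)
    (hmin : ∀ q : ℚ[X], q.natDegree < f.natDegree →
      (q.coeff 1 + q.coeff 2 * t + q.coeff 3 * (t ^ 2 - δ) : ℂ) = 0 →
      (q.coeff 0 - q.coeff 2 * δ - q.coeff 3 * (t * δ) : ℂ) = 0 →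
      ∀ i < f.natDegree, q.coeff i = 0) :
    minpoly ℚ M = f := by
  refine (minpoly.unique' ℚ M hf ?_ ?_).symm
  · exact (h.aeval_eq_zero_iff h₁ h₂ hl₃ ht hdeg).2 ⟨hf1, hf0⟩
  · intro q hq
    rw [or_iff_not_imp_right, not_not]
    intro h0
    by_contra hq0
    have hq' : q.natDegree < f.natDegree := natDegree_lt_natDegree hq0 hq
    have h4 : q.coeff 4 = 0 := coeff_eq_zero_of_natDegree_lt (by omega)
    have := (h.aeval_eq_zero_iff h₁ h₂ hl₃ ht (by omega)).1 h0
    rw [h4] at this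
    have hz := hmin q hq' (by simpa using this.1) (by simpa using this.2) q.natDegree hq'
    exact hq0 (leadingCoeff_eq_zero.1 hz)

theorem minpoly_eq_quadratic (h : ActsUnitarily τ₁ τ₂ M l₁ l₃ δ) (h₁ : τ₁.im ≠ 0)
    (h₂ : τ₂.im ≠ 0) (hl₃ : l₃ ≠ 0) {a b : ℚ} (ht : l₁ + δ * conj l₁ = -a) (hδ : δ = b) :
    minpoly ℚ M = X ^ 2 + C a * X + C b := by
  have hd : (X ^ 2 + C a * X + C b : ℚ[X]).natDegree = 2 := by compute_degree!
  refine h.minpoly_eq h₁ h₂ hl₃ ht (by monicity!) (by rw [hd]; norm_num) ?_ ?_ ?_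
  · simp [coeff_C]
  · simp [coeff_C, hδ]
  · rw [hd]
    intro q hq e1 e0
    have c2 : q.coeff 2 = 0 := coeff_eq_zero_of_natDegree_lt (by omega)
    have c3 : q.coeff 3 = 0 := coeff_eq_zero_of_natDegree_lt (by omega)
    simp [c2, c3] at e1 e0
    intro i hi
    interval_cases i <;> assumption

theorem minpoly_eq_cubic (h : ActsUnitarily τ₁ τ₂ M l₁ l₃ δ) (h₁ : τ₁.im ≠ 0)
    (h₂ : τ₂.im ≠ 0) (hl₃ : l₃ ≠ 0) (hδ : δ.im ≠ 0) {t : ℂ} (ht : l₁ + δ * conj l₁ = t)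
    {a b c : ℚ} (e₁ : b + a * t + (t ^ 2 - δ) = 0) (e₀ : c - a * δ - t * δ = 0) :
    minpoly ℚ M = X ^ 3 + C a * X ^ 2 + C b * X + C c := by
  have hd : (X ^ 3 + C a * X ^ 2 + C b * X + C c : ℚ[X]).natDegree = 3 := by compute_degree!
  refine h.minpoly_eq h₁ h₂ hl₃ ht (by monicity!) (by rw [hd]; norm_num) ?_ ?_ ?_
  · simpa [coeff_X, coeff_C] using e₁
  · simpa [coeff_X, coeff_C] using e₀
  · rw [hd]
    intro q hq e1 e0
    have c3 : q.coeff 3 = 0 := coeff_eq_zero_of_natDegree_lt (by omega)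
    simp only [c3, Rat.cast_zero, zero_mul, add_zero, sub_zero] at e1 e0
    have k := rat_add_rat_mul_eq_zero hδ (a := q.coeff 0) (b := -q.coeff 2)
      (by push_cast; linear_combination e0)
    have c2 : q.coeff 2 = 0 := by simpa using k.2
    simp [c2] at e1
    intro i hi
    interval_cases i
    · exact k.1
    · exact e1
    · exact c2

theorem minpoly_eq_quartic_of_trace_eq_zero (h : ActsUnitarily τ₁ τ₂ M l₁ l₃ δ) (h₁ : τ₁.im ≠ 0)
    (h₂ : τ₂.im ≠ 0) (hl₃ : l₃ ≠ 0) (hδ : δ.im ≠ 0) (ht : l₁ + δ * conj l₁ = 0)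
    {a : ℚ} (e : δ ^ 2 - a * δ + 1 = 0) :
    minpoly ℚ M = X ^ 4 + C a * X ^ 2 + 1 := by
  have hd := natDegree_palindromic a
  refine h.minpoly_eq h₁ h₂ hl₃ ht (by monicity!) (by rw [hd]; norm_num) ?_ ?_ ?_
  · simp [coeff_one]
  · simp [coeff_one]
    linear_combination e
  · rw [hd]
    intro q hq e1 e0
    have k0 := rat_add_rat_mul_eq_zero hδ (a := q.coeff 0) (b := -q.coeff 2)
      (by push_cast; linear_combination e0)
    have k1 := rat_add_rat_mul_eq_zero hδ (a := q.coeff 1) (b := -q.coeff 3)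
      (by push_cast; linear_combination e1)
    intro i hi
    interval_cases i
    · exact k0.1
    · exact k1.1
    · simpa using k0.2
    · simpa using k1.2

theorem minpoly_eq_quartic_of_det_eq_neg_one (h : ActsUnitarily τ₁ τ₂ M l₁ l₃ (-1))
    (h₁ : τ₁.im ≠ 0) (h₂ : τ₂.im ≠ 0) (hl₃ : l₃ ≠ 0) {t : ℂ} (hti : t.im ≠ 0)
    (ht : l₁ - conj l₁ = t) {a : ℚ} (e : t ^ 2 = -2 - a) :
    minpoly ℚ M = X ^ 4 + C a * X ^ 2 + 1 := by
  have hd := natDegree_palindromic a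
  refine h.minpoly_eq h₁ h₂ hl₃ (t := t) (by rw [← ht]; ring) (by monicity!)
    (by rw [hd]; norm_num) ?_ ?_ ?_
  · simp [coeff_one]
    linear_combination t * e
  · simp [coeff_one]
    linear_combination e
  · rw [hd]
    intro q hq e1 e0
    have k0 := rat_add_rat_mul_eq_zero hti (a := q.coeff 0 + q.coeff 2) (b := q.coeff 3)
      (by push_cast; linear_combination e0)
    have k1 := rat_add_rat_mul_eq_zero hti (a := q.coeff 1 - q.coeff 3 - a * q.coeff 3)
      (b := q.coeff 2)
      (by push_cast; linear_combination e1 - (q.coeff 3 : ℂ) * e)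
    have c3 := k0.2
    have c2 := k1.2
    intro i hi
    interval_cases i
    · simpa [c2] using k0.1
    · simpa [c3] using k1.1
    · exact c2
    · exact c3

/-- Blocks are determined by their multipliers, so a block form is checked on multipliers. -/
theorem hasBlockForm (h : ActsUnitarily τ₁ τ₂ M l₁ l₃ δ) (h₁ : τ₁.im ≠ 0) (h₂ : τ₂.im ≠ 0)
    (hIII : IsTypeIII M) {p : ℚ[X]} (hp : minpoly ℚ M.toBlocks₁₁ = p) {F G : Mat2 → Mat2 → Mat2}
    (hF : Acts (F M.toBlocks₁₁ M.toBlocks₁₂) τ₁ τ₂ l₃)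
    (hG : Acts (G M.toBlocks₁₁ M.toBlocks₁₂) τ₂ τ₂ (δ * conj l₁)) : HasBlockForm M p F G := by
  obtain ⟨⟨d1, d2, -, -⟩, -⟩ := hIII
  refine ⟨Matrix.GeneralLinearGroup.mkOfDetNeZero _ d1,
    Matrix.GeneralLinearGroup.mkOfDetNeZero _ d2, hp, ?_⟩
  conv_lhs => rw [← M.fromBlocks_toBlocks]
  change _ = Matrix.fromBlocks M.toBlocks₁₁ M.toBlocks₁₂ (F M.toBlocks₁₁ M.toBlocks₁₂)
    (G M.toBlocks₁₁ M.toBlocks₁₂)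
  rw [h.acts₂₁.unique h₁ hF, h.acts₂₂.unique h₂ hG]

end ActsUnitarily

/-! ### Minimal polynomials and block forms for the two kinds of determinant -/

theorem not_isTypeIII_of_isTypeI {M : Mat4} (h : IsTypeI M) : ¬ IsTypeIII M := by
  intro h'
  apply h'.1.2.1
  rw [h.2.2.1, Matrix.det_zero]

theorem not_isTypeIII_of_isTypeII {M : Mat4} (h : IsTypeII M) : ¬ IsTypeIII M := by
  intro h'
  apply h'.1.1
  rw [h.2.2.1, Matrix.det_zero]

theorem sub_conj_ne_zero {l : ℂ} (h : l.im ≠ 0) : l - conj l ≠ 0 := by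
  intro h0
  have := congrArg Complex.im h0
  simp at this
  exact h this

namespace ActsUnitarily

variable {τ₁ τ₂ l₁ l₃ δ : ℂ} {M : Mat4}

/-- The multiplier of `A₂⁻¹`, expressed through `l₃` by means of `det m = δ`. -/
theorem acts_inv₁₂ (h : ActsUnitarily τ₁ τ₂ M l₁ l₃ δ) (h₁ : τ₁.im ≠ 0) (h₂ : τ₂.im ≠ 0)
    (hl₃ : l₃ ≠ 0) (hIII : IsTypeIII M) {κ : ℚ} (hκ : l₁ * conj l₁ = κ) :
    Acts M.toBlocks₁₂⁻¹ τ₁ τ₂ (-(conj δ * l₃ / (1 - κ))) := by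
  have hs : ((τ₂.im / τ₁.im : ℝ) : ℂ) ≠ 0 := by
    simpa using div_ne_zero h₂ h₁
  have hd := h.norm_det
  have hn := h.norm_col
  have hδ : δ ≠ 0 := left_ne_zero_of_mul_eq_one hd
  have hl₃' : conj l₃ ≠ 0 := by simpa using hl₃
  refine (h.acts₁₂.inv hIII.1.2.1 (neg_ne_zero.2 (mul_ne_zero (mul_ne_zero hs hδ) hl₃'))).congr ?_
  rw [← hκ, ← hn, add_sub_cancel_left]
  field_simp
  linear_combination hd

theorem acts_conj₁₂ (h : ActsUnitarily τ₁ τ₂ M l₁ l₃ δ) (hIII : IsTypeIII M) (h₁ : τ₁.im ≠ 0)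
    (h₂ : τ₂.im ≠ 0) (hl₃ : l₃ ≠ 0) {B : Mat2} {l : ℂ} (hB : Acts B τ₁ τ₁ l) :
    Acts (M.toBlocks₁₂⁻¹ * B * M.toBlocks₁₂) τ₂ τ₂ l := by
  have hs : ((τ₂.im / τ₁.im : ℝ) : ℂ) ≠ 0 := by
    simpa using div_ne_zero h₂ h₁
  have hδ : δ ≠ 0 := left_ne_zero_of_mul_eq_one h.norm_det
  have hl₃' : conj l₃ ≠ 0 := by simpa using hl₃
  have h0 := neg_ne_zero.2 (mul_ne_zero (mul_ne_zero hs hδ) hl₃')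
  refine (((h.acts₁₂.inv hIII.1.2.1 h0).mul hB).mul h.acts₁₂).congr ?_
  rw [mul_right_comm, inv_mul_cancel₀ h0, one_mul]

theorem minpoly_toBlocks₁₁ (h : ActsUnitarily τ₁ τ₂ M l₁ l₃ δ) (h₁ : τ₁.im ≠ 0)
    (hl₁ : l₁.im ≠ 0) {x κ : ℚ} (hx : l₁ + conj l₁ = -x) (hκ : l₁ * conj l₁ = κ) :
    minpoly ℚ M.toBlocks₁₁ = X ^ 2 + C x * X + C κ :=
  h.acts₁₁.minpoly_eq h₁ hl₁ (by linear_combination l₁ * hx - hκ)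

theorem minpoly_of_det_eq_one (h : ActsUnitarily τ₁ τ₂ M l₁ l₃ 1) (h₁ : τ₁.im ≠ 0)
    (h₂ : τ₂.im ≠ 0) (hl₃ : l₃ ≠ 0) {x : ℚ} (hx : l₁ + conj l₁ = -x) :
    minpoly ℚ M = X ^ 2 + C x * X + 1 := by
  rw [← C_1]
  exact h.minpoly_eq_quadratic h₁ h₂ hl₃ (by linear_combination hx) (by simp)

/-- The trace is `l₁ - l̄₁`, purely imaginary with square `x² - 4κ`. -/
theorem minpoly_of_det_eq_neg_one (h : ActsUnitarily τ₁ τ₂ M l₁ l₃ (-1)) (h₁ : τ₁.im ≠ 0)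
    (h₂ : τ₂.im ≠ 0) (hl₁ : l₁.im ≠ 0) (hl₃ : l₃ ≠ 0) {x κ : ℚ} (hx : l₁ + conj l₁ = -x)
    (hκ : l₁ * conj l₁ = κ) :
    minpoly ℚ M = X ^ 4 + C (4 * κ - x ^ 2 - 2) * X ^ 2 + 1 :=
  h.minpoly_eq_quartic_of_det_eq_neg_one h₁ h₂ hl₃ (t := l₁ - conj l₁) (by simpa using hl₁) rfl
    (by push_cast; linear_combination (l₁ + conj l₁ - x) * hx - 4 * hκ)

theorem sq_of_det_eq_neg_one (h : ActsUnitarily τ₁ τ₂ M l₁ l₃ (-1)) {x κ : ℚ}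
    (hx : l₁ + conj l₁ = -x) (hκ : l₁ * conj l₁ = κ) :
    ActsUnitarily τ₁ τ₂ (M ^ 2) (-x * l₁ + (1 - 2 * κ)) ((l₁ - conj l₁) * l₃) 1 := by
  have e := h.sq
  have e1 : (l₁ + -1 * conj l₁) * l₁ - -1 = -x * l₁ + (1 - 2 * κ) := by
    linear_combination l₁ * hx - 2 * hκ
  have e2 : (l₁ + -1 * conj l₁) * l₃ = (l₁ - conj l₁) * l₃ := by ring
  rwa [e1, e2, neg_one_sq] at e

/-- Here the trace is `2 l₁`, and the eigenvalues are `-ε` and `2 l₁ + ε`. -/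
theorem minpoly_of_det_eq_sq_div (h : ActsUnitarily τ₁ τ₂ M l₁ l₃ δ) (h₁ : τ₁.im ≠ 0)
    (h₂ : τ₂.im ≠ 0) (hl₁ : l₁.im ≠ 0) (hl₃ : l₃ ≠ 0) {ε κ : ℚ} (hε : IsSign ε) (hκ0 : κ ≠ 0)
    (hx : l₁ + conj l₁ = -(2 * ε * κ)) (hκ : l₁ * conj l₁ = κ) (hδ : δ = l₁ ^ 2 / κ) :
    minpoly ℚ M = X ^ 3 + C (ε * (4 * κ - 1)) * X ^ 2 + C (4 * κ - 1) * X + C ε := by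
  have hκ0' : (κ : ℂ) ≠ 0 := by exact_mod_cast hκ0
  have hε2 : (ε : ℂ) ^ 2 = 1 := by rcases hε with rfl | rfl <;> simp
  have hq : l₁ ^ 2 = -(2 * ε * κ) * l₁ - κ := by linear_combination l₁ * hx - hκ
  have hδ' : δ = -(2 * ε) * l₁ - 1 := by
    rw [hδ, hq]; field_simp
  have hδi : δ.im ≠ 0 := by
    rw [hδ']
    rcases hε with rfl | rfl <;> simpa using hl₁
  have ht : l₁ + δ * conj l₁ = 2 * l₁ := by
    rw [hδ]
    field_simp
    linear_combination l₁ * hκ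
  refine h.minpoly_eq_cubic h₁ h₂ hl₃ hδi ht ?_ ?_
  · push_cast
    rw [hδ']
    linear_combination 4 * hq
  · push_cast
    rw [hδ']
    linear_combination (2 * (4 * κ - 1) * l₁) * hε2 + (4 * ε) * hq - 8 * κ * l₁ * hε2

/-- Here the trace is zero, so that `M²` acts as the scalar `-δ`. -/
theorem minpoly_of_det_eq_neg_sq_div (h : ActsUnitarily τ₁ τ₂ M l₁ l₃ δ) (h₁ : τ₁.im ≠ 0)
    (h₂ : τ₂.im ≠ 0) (hl₁ : l₁.im ≠ 0) (hl₃ : l₃ ≠ 0) {ε κ : ℚ} (hε : IsSign ε) (hκ0 : κ ≠ 0)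
    (hx : l₁ + conj l₁ = -(2 * ε * κ)) (hκ : l₁ * conj l₁ = κ) (hδ : δ = -(l₁ ^ 2 / κ)) :
    minpoly ℚ M = X ^ 4 + C (2 - 4 * κ) * X ^ 2 + 1 ∧ IsTypeI (M ^ 2) := by
  have hκ0' : (κ : ℂ) ≠ 0 := by exact_mod_cast hκ0
  have hε2 : (ε : ℂ) ^ 2 = 1 := by rcases hε with rfl | rfl <;> simp
  have hq : l₁ ^ 2 = -(2 * ε * κ) * l₁ - κ := by linear_combination l₁ * hx - hκ
  have hδ' : δ = (2 * ε) * l₁ + 1 := by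
    rw [hδ, hq]; field_simp; ring
  have hδi : δ.im ≠ 0 := by
    rw [hδ']
    rcases hε with rfl | rfl <;> simpa using hl₁
  have ht : l₁ + δ * conj l₁ = 0 := by
    rw [hδ]
    field_simp
    linear_combination -l₁ * hκ
  refine ⟨h.minpoly_eq_quartic_of_trace_eq_zero h₁ h₂ hl₃ hδi ht ?_, ?_⟩
  · push_cast
    rw [hδ']
    linear_combination 4 * ε ^ 2 * hq + (-8 * ε * κ * l₁ - 4 * κ) * hε2
  · have e := h.sq
    rw [ht, zero_mul, zero_mul] at e
    exact e.isTypeI h₁ h₂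

theorem det_mul_conj_of_eq_div {σ κ : ℚ} (hκ0 : κ ≠ 0) (hκ : l₁ * conj l₁ = κ)
    (hδ : δ = σ * (l₁ ^ 2 / κ)) : δ * conj l₁ = σ * l₁ := by
  have hκ0' : (κ : ℂ) ≠ 0 := by exact_mod_cast hκ0
  rw [hδ]
  field_simp
  linear_combination σ * l₁ * hκ

theorem hasBlockForm_of_det_eq_sign {σ x κ : ℚ} (h : ActsUnitarily τ₁ τ₂ M l₁ l₃ σ)
    (h₁ : τ₁.im ≠ 0) (h₂ : τ₂.im ≠ 0) (hl₁ : l₁.im ≠ 0) (hl₃ : l₃ ≠ 0) (hIII : IsTypeIII M)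
    (hσ : IsSign σ) (hκ1 : κ ≠ 1) (hx : l₁ + conj l₁ = -x) (hκ : l₁ * conj l₁ = κ) :
    HasBlockForm M (X ^ 2 + C x * X + C κ) (fun _ A₂ => (-(σ * (1 - κ))) • A₂⁻¹)
      (fun A₁ A₂ => (σ * κ) • (A₂⁻¹ * A₁⁻¹ * A₂)) := by
  have hκ1' : (1 - κ : ℂ) ≠ 0 := sub_ne_zero.2 (by exact_mod_cast hκ1.symm)
  have hl₁0 : l₁ ≠ 0 := fun h0 => hl₁ (by rw [h0]; rfl)
  refine h.hasBlockForm h₁ h₂ hIII (h.minpoly_toBlocks₁₁ h₁ hl₁ hx hκ)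
    (((h.acts_inv₁₂ h₁ h₂ hl₃ hIII hκ).smul _).congr ?_)
    (((h.acts_conj₁₂ hIII h₁ h₂ hl₃ (h.acts₁₁.inv hIII.1.1 hl₁0)).smul _).congr ?_)
  · have hσ2 : (σ : ℂ) ^ 2 = 1 := by rcases hσ with rfl | rfl <;> simp
    rw [map_ratCast]
    push_cast
    field_simp
    linear_combination hσ2
  · push_cast
    field_simp
    linear_combination -σ * hκ

theorem hasBlockForm_of_det_eq_sign_of_trace_eq_zero {σ κ : ℚ}
    (h : ActsUnitarily τ₁ τ₂ M l₁ l₃ σ)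
    (h₁ : τ₁.im ≠ 0) (h₂ : τ₂.im ≠ 0) (hl₁ : l₁.im ≠ 0) (hl₃ : l₃ ≠ 0) (hIII : IsTypeIII M)
    (hσ : IsSign σ) (hκ1 : κ ≠ 1) (hx : l₁ + conj l₁ = 0) (hκ : l₁ * conj l₁ = κ) :
    HasBlockForm M (X ^ 2 + C κ) (fun _ A₂ => (-(σ * (1 - κ))) • A₂⁻¹)
      (fun A₁ A₂ => (-σ) • (A₂⁻¹ * A₁ * A₂)) := by
  have hκ1' : (1 - κ : ℂ) ≠ 0 := sub_ne_zero.2 (by exact_mod_cast hκ1.symm)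
  have hp := h.minpoly_toBlocks₁₁ (x := 0) h₁ hl₁ (by simpa using hx) hκ
  rw [C_0, zero_mul, add_zero] at hp
  refine h.hasBlockForm h₁ h₂ hIII hp
    (((h.acts_inv₁₂ h₁ h₂ hl₃ hIII hκ).smul _).congr ?_)
    (((h.acts_conj₁₂ hIII h₁ h₂ hl₃ h.acts₁₁).smul _).congr ?_)
  · have hσ2 : (σ : ℂ) ^ 2 = 1 := by rcases hσ with rfl | rfl <;> simp
    rw [map_ratCast]
    push_cast
    field_simp
    linear_combination hσ2
  · push_cast
    linear_combination -σ * hx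

theorem hasBlockForm_of_det_eq_sq_div {σ ε κ : ℚ} (h : ActsUnitarily τ₁ τ₂ M l₁ l₃ δ)
    (h₁ : τ₁.im ≠ 0) (h₂ : τ₂.im ≠ 0) (hl₁ : l₁.im ≠ 0) (hl₃ : l₃ ≠ 0) (hIII : IsTypeIII M)
    (hσ : IsSign σ) (hκ0 : κ ≠ 0) (hκ1 : κ ≠ 1)
    (hx : l₁ + conj l₁ = -(2 * ε * κ)) (hκ : l₁ * conj l₁ = κ) (hδ : δ = σ * (l₁ ^ 2 / κ)) :
    HasBlockForm M (X ^ 2 + C (2 * ε * κ) * X + C κ)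
      (fun A₁ A₂ => (-(σ * ((1 - κ) / κ))) • (A₂⁻¹ * A₁ ^ 2))
      (fun A₁ A₂ => σ • (A₂⁻¹ * A₁ * A₂)) := by
  have hκ0' : (κ : ℂ) ≠ 0 := by exact_mod_cast hκ0
  have hκ1' : (1 - κ : ℂ) ≠ 0 := sub_ne_zero.2 (by exact_mod_cast hκ1.symm)
  have hσ2 : (σ : ℂ) ^ 2 = 1 := by rcases hσ with rfl | rfl <;> simp
  refine h.hasBlockForm h₁ h₂ hIII
    (h.minpoly_toBlocks₁₁ h₁ hl₁ (by push_cast; exact hx) hκ)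
    (((h.acts_inv₁₂ h₁ h₂ hl₃ hIII hκ).mul (h.acts₁₁.pow 2)).smul _ |>.congr ?_)
    (((h.acts_conj₁₂ hIII h₁ h₂ hl₃ h.acts₁₁).smul _).congr
      (det_mul_conj_of_eq_div hκ0 hκ hδ).symm)
  have hc : conj δ * l₁ ^ 2 = σ * κ := by
    rw [hδ, map_mul, map_div₀, map_ratCast, map_ratCast, map_pow]
    field_simp
    linear_combination σ * (l₁ * conj l₁ + κ) * hκ
  push_cast
  field_simp
  linear_combination σ * hc + κ * hσ2

end ActsUnitarily

/-! ### The three lists of forms -/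

theorem HasBlockForm.congr {M : Mat4} {p p' : ℚ[X]} {F F' G G' : Mat2 → Mat2 → Mat2}
    (h : HasBlockForm M p F G) (hp : p = p') (hF : ∀ A B, F A B = F' A B)
    (hG : ∀ A B, G A B = G' A B) : HasBlockForm M p' F' G' := by
  obtain rfl : F = F' := funext₂ hF
  obtain rfl : G = G' := funext₂ hG
  exact hp ▸ h

/-- The multiplier `l₁` of `A₁` has trace `-x` and norm `κ`, and `det m` is the sign `σ`. -/
structure SignDet (l₁ δ : ℂ) (σ x κ : ℚ) : Prop where
  sign : IsSign σ
  det_eq : δ = σ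
  add_conj : l₁ + conj l₁ = -x
  mul_conj : l₁ * conj l₁ = κ

/-- The multiplier `l₁` of `A₁` has trace `-2εκ` and norm `κ`, and `det m = σ l₁² / |l₁|²`, for signs
`σ, ε`.  Then the multiplier `δ l̄₁` of `A₄` is `σ l₁`. -/
structure SquareDet (l₁ δ : ℂ) (σ ε κ : ℚ) : Prop where
  sign : IsSign σ
  sign' : IsSign ε
  det_eq : δ = σ * (l₁ ^ 2 / κ)
  add_conj : l₁ + conj l₁ = -(2 * ε * κ)
  mul_conj : l₁ * conj l₁ = κ

namespace ActsUnitarily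

variable {τ₁ τ₂ l₁ l₃ δ : ℂ} {M : Mat4}

/-- In each case the minimal polynomial is computed; the conclusions about the other minimal
polynomials in the list are vacuous, because the values at `3` differ or because `M²` has another
type. -/
theorem formsSqrtNegThree (h : ActsUnitarily τ₁ τ₂ M l₁ l₃ δ) (h₁ : τ₁.im ≠ 0) (h₂ : τ₂.im ≠ 0)
    (hl₁ : l₁.im ≠ 0) (hl₃ : l₃ ≠ 0) (hIII : IsTypeIII M)
    (hc : (∃ σ, SignDet l₁ δ σ 0 (3 / 4)) ∨
      ∃ σ ε κ, SquareDet l₁ δ σ ε κ ∧ (κ = 1 / 4 ∨ κ = 3 / 4)) : FormsSqrtNegThree M := by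
  rcases hc with ⟨σ, hσ, rfl, hx, hκ⟩ | ⟨σ, ε, κ, ⟨hσ, hε, hδ, hx, hκ⟩, hk⟩
  · have hx' : l₁ + conj l₁ = 0 := by simpa using hx
    have hform := h.hasBlockForm_of_det_eq_sign_of_trace_eq_zero h₁ h₂ hl₁ hl₃ hIII hσ
      (by norm_num) hx' hκ
    rcases hσ with rfl | rfl
    · rw [Rat.cast_one] at h
      have hm : minpoly ℚ M = X ^ 2 + 1 := by simpa using h.minpoly_of_det_eq_one h₁ h₂ hl₃ hx
      have key : ∀ p, minpoly ℚ M = p → eval 3 p = 10 := by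
        rintro p rfl; rw [hm]; norm_num
      refine ⟨Or.inl hm, fun _ => ?_, fun e => ?_, fun ε hε e => ?_, fun e => ?_, fun ε hε e => ?_,
        fun e => ?_⟩
      · exact hform.congr rfl (fun A B => by rw [← neg_smul]; norm_num) (fun A B => by simp)
      · have := key _ e; norm_num at this
      · have := key _ e; rcases hε with rfl | rfl <;> norm_num at this
      · have := key _ e; norm_num at this
      · have := key _ e; rcases hε with rfl | rfl <;> norm_num at this
      · have := key _ e; norm_num at this
    · rw [Rat.cast_neg, Rat.cast_one] at h
      have hm : minpoly ℚ M = X ^ 4 + X ^ 2 + 1 := by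
        rw [h.minpoly_of_det_eq_neg_one h₁ h₂ hl₁ hl₃ hx hκ]
        norm_num
      have hsq : IsTypeIII (M ^ 2) := by
        refine (h.sq_of_det_eq_neg_one hx hκ).isTypeIII h₁ h₂ ?_
          (mul_ne_zero (sub_conj_ne_zero hl₁) hl₃)
        norm_num
      have key : ∀ p, minpoly ℚ M = p → eval 3 p = 91 := by
        rintro p rfl; rw [hm]; norm_num
      refine ⟨Or.inr (Or.inl ⟨hm, hsq⟩), fun e => ?_, fun _ _ => ?_, fun ε hε e => ?_,
        fun _ hI => absurd hsq (not_isTypeIII_of_isTypeI hI), fun ε hε e => ?_,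
        fun _ hI => absurd hsq (not_isTypeIII_of_isTypeI hI)⟩
      · have := key _ e; norm_num at this
      · exact hform.congr rfl (fun A B => by norm_num) (fun A B => by simp)
      · have := key _ e; rcases hε with rfl | rfl <;> norm_num at this
      · have := key _ e; rcases hε with rfl | rfl <;> norm_num at this
  · have hκ0 : κ ≠ 0 := by rcases hk with rfl | rfl <;> norm_num
    have hκ1 : κ ≠ 1 := by rcases hk with rfl | rfl <;> norm_num
    have hform := h.hasBlockForm_of_det_eq_sq_div h₁ h₂ hl₁ hl₃ hIII hσ hκ0 hκ1 hx hκ hδ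
    rcases hσ with rfl | rfl
    · have hm := h.minpoly_of_det_eq_sq_div h₁ h₂ hl₁ hl₃ hε hκ0 hx hκ (by simpa using hδ)
      rcases hk with rfl | rfl
      · have hm : minpoly ℚ M = X ^ 3 + C ε := by rw [hm]; norm_num
        have key : ∀ p, minpoly ℚ M = p → eval 3 p = 27 + ε := by
          rintro p rfl; rw [hm]; norm_num
        refine ⟨Or.inr (Or.inr (Or.inl ⟨ε, hε, hm⟩)), fun e => ?_, fun e => ?_, fun ε' hε' e => ?_,
          fun e => ?_, fun ε' hε' e => ?_, fun e => ?_⟩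
        · have := key _ e; rcases hε with rfl | rfl <;> norm_num at this
        · have := key _ e; rcases hε with rfl | rfl <;> norm_num at this
        · obtain rfl : ε' = ε := by have := key _ e; simp at this; linarith
          exact hform.congr (by ring_nf) (fun A B => by rw [← neg_smul]; norm_num)
            (fun A B => by simp)
        · have := key _ e; rcases hε with rfl | rfl <;> norm_num at this
        · have := key _ e; rcases hε with rfl | rfl <;> rcases hε' with rfl | rfl <;>
            norm_num at this
        · have := key _ e; rcases hε with rfl | rfl <;> norm_num at this
      · have hm : minpoly ℚ M = X ^ 3 + C (2 * ε) * X ^ 2 + 2 * X + C ε := by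
          have c2 : (C 2 : ℚ[X]) = 2 := map_ofNat C 2
          rw [hm]
          norm_num
          simp only [c2]
          ring
        have key : ∀ p, minpoly ℚ M = p → eval 3 p = 33 + 19 * ε := by
          rintro p rfl; rw [hm]; norm_num; ring
        refine ⟨Or.inr (Or.inr (Or.inr (Or.inr (Or.inl ⟨ε, hε, hm⟩)))), fun e => ?_, fun e => ?_,
          fun ε' hε' e => ?_, fun e => ?_, fun ε' hε' e => ?_, fun e => ?_⟩
        · have := key _ e; rcases hε with rfl | rfl <;> norm_num at this
        · have := key _ e; rcases hε with rfl | rfl <;> norm_num at this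
        · have := key _ e; rcases hε with rfl | rfl <;> rcases hε' with rfl | rfl <;>
            norm_num at this
        · have := key _ e; rcases hε with rfl | rfl <;> norm_num at this
        · obtain rfl : ε' = ε := by have := key _ e; simp at this; linarith
          exact hform.congr (by ring_nf) (fun A B => by rw [← neg_smul]; norm_num)
            (fun A B => by simp)
        · have := key _ e; rcases hε with rfl | rfl <;> norm_num at this
    · obtain ⟨hm, hsq⟩ := h.minpoly_of_det_eq_neg_sq_div h₁ h₂ hl₁ hl₃ hε hκ0 hx hκ
        (by simpa using hδ)
      have hnot := not_isTypeIII_of_isTypeI hsq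
      rcases hk with rfl | rfl
      · have hm : minpoly ℚ M = X ^ 4 + X ^ 2 + 1 := by rw [hm]; norm_num
        have key : ∀ p, minpoly ℚ M = p → eval 3 p = 91 := by
          rintro p rfl; rw [hm]; norm_num
        refine ⟨Or.inr (Or.inr (Or.inr (Or.inl ⟨hm, hsq⟩))), fun e => ?_,
          fun _ hI => absurd hI hnot, fun ε' hε' e => ?_,
          fun _ _ => ⟨ε, hε, ?_⟩, fun ε' hε' e => ?_, fun e => ?_⟩
        · have := key _ e; norm_num at this
        · have := key _ e; rcases hε' with rfl | rfl <;> norm_num at this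
        · exact hform.congr (by ring_nf) (fun A B => by norm_num) (fun A B => by simp)
        · have := key _ e; rcases hε' with rfl | rfl <;> norm_num at this
        · have := key _ e; norm_num at this
      · have hm : minpoly ℚ M = X ^ 4 - X ^ 2 + 1 := by rw [hm]; norm_num; ring
        have key : ∀ p, minpoly ℚ M = p → eval 3 p = 73 := by
          rintro p rfl; rw [hm]; norm_num
        refine ⟨Or.inr (Or.inr (Or.inr (Or.inr (Or.inr ⟨hm, hsq⟩)))), fun e => ?_,
          fun _ hI => absurd hI hnot, fun ε' hε' e => ?_, fun e => ?_, fun ε' hε' e => ?_,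
          fun _ _ => ⟨ε, hε, ?_⟩⟩
        · have := key _ e; norm_num at this
        · have := key _ e; rcases hε' with rfl | rfl <;> norm_num at this
        · have := key _ e; norm_num at this
        · have := key _ e; rcases hε' with rfl | rfl <;> norm_num at this
        · exact hform.congr (by ring_nf) (fun A B => by norm_num) (fun A B => by simp)

theorem formsSqrtNegTwo (h : ActsUnitarily τ₁ τ₂ M l₁ l₃ δ) (h₁ : τ₁.im ≠ 0) (h₂ : τ₂.im ≠ 0)
    (hl₁ : l₁.im ≠ 0) (hl₃ : l₃ ≠ 0) (hIII : IsTypeIII M)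
    (hc : (∃ σ, SignDet l₁ δ σ 0 (1 / 2)) ∨ ∃ σ ε, IsSign ε ∧ SignDet l₁ δ σ ε (3 / 4)) :
    FormsSqrtNegTwo M := by
  rcases hc with ⟨σ, hσ, rfl, hx, hκ⟩ | ⟨σ, ε, hε, hσ, rfl, hx, hκ⟩
  · have hx' : l₁ + conj l₁ = 0 := by simpa using hx
    have hform := h.hasBlockForm_of_det_eq_sign_of_trace_eq_zero h₁ h₂ hl₁ hl₃ hIII hσ
      (by norm_num) hx' hκ
    rcases hσ with rfl | rfl
    · rw [Rat.cast_one] at h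
      have hm : minpoly ℚ M = X ^ 2 + 1 := by simpa using h.minpoly_of_det_eq_one h₁ h₂ hl₃ hx
      have key : ∀ p, minpoly ℚ M = p → eval 3 p = 10 := by
        rintro p rfl; rw [hm]; norm_num
      refine ⟨Or.inl hm, fun _ => ?_, fun e => ?_, fun ε hε e => ?_, fun e => ?_⟩
      · exact hform.congr rfl (fun A B => by rw [← neg_smul]; norm_num) (fun A B => by simp)
      · have := key _ e; norm_num at this
      · have := key _ e; rcases hε with rfl | rfl <;> norm_num at this
      · have := key _ e; norm_num at this
    · rw [Rat.cast_neg, Rat.cast_one] at h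
      have hm : minpoly ℚ M = X ^ 4 + 1 := by
        rw [h.minpoly_of_det_eq_neg_one h₁ h₂ hl₁ hl₃ hx hκ]
        norm_num
      have hsq : IsTypeII (M ^ 2) := by
        have e := h.sq_of_det_eq_neg_one hx hκ
        have e0 : -((0 : ℚ) : ℂ) * l₁ + (1 - 2 * ((1 / 2 : ℚ) : ℂ)) = 0 := by norm_num
        rw [e0] at e
        exact e.isTypeII h₁ h₂
      have key : ∀ p, minpoly ℚ M = p → eval 3 p = 82 := by
        rintro p rfl; rw [hm]; norm_num
      refine ⟨Or.inr (Or.inl ⟨hm, hsq⟩), fun e => ?_, fun _ _ => ?_, fun ε hε e => ?_,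
        fun _ hI => absurd hI (not_isTypeIII_of_isTypeII hsq)⟩
      · have := key _ e; norm_num at this
      · exact hform.congr rfl (fun A B => by norm_num) (fun A B => by simp)
      · have := key _ e; rcases hε with rfl | rfl <;> norm_num at this
  · have hform := h.hasBlockForm_of_det_eq_sign h₁ h₂ hl₁ hl₃ hIII hσ (by norm_num) hx hκ
    rcases hσ with rfl | rfl
    · rw [Rat.cast_one] at h
      have hm := h.minpoly_of_det_eq_one h₁ h₂ hl₃ hx
      have key : ∀ p, minpoly ℚ M = p → eval 3 p = 10 + 3 * ε := by
        rintro p rfl; rw [hm]; norm_num; ring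
      refine ⟨Or.inr (Or.inr (Or.inl ⟨ε, hε, hm⟩)), fun e => ?_, fun e => ?_, fun ε' hε' e => ?_,
        fun e => ?_⟩
      · have := key _ e; rcases hε with rfl | rfl <;> norm_num at this
      · have := key _ e; rcases hε with rfl | rfl <;> norm_num at this
      · obtain rfl : ε' = ε := by have := key _ e; simp at this; linarith
        exact hform.congr rfl (fun A B => by rw [← neg_smul]; norm_num) (fun A B => by simp)
      · have := key _ e; rcases hε with rfl | rfl <;> norm_num at this
    · rw [Rat.cast_neg, Rat.cast_one] at h
      have hm : minpoly ℚ M = X ^ 4 + 1 := by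
        rw [h.minpoly_of_det_eq_neg_one h₁ h₂ hl₁ hl₃ hx hκ]
        rcases hε with rfl | rfl <;> norm_num
      have hsq : IsTypeIII (M ^ 2) := by
        refine (h.sq_of_det_eq_neg_one hx hκ).isTypeIII h₁ h₂ (fun h0 => hl₁ ?_)
          (mul_ne_zero (sub_conj_ne_zero hl₁) hl₃)
        have := congrArg Complex.im h0
        rcases hε with rfl | rfl <;> norm_num at this <;> exact this
      have key : ∀ p, minpoly ℚ M = p → eval 3 p = 82 := by
        rintro p rfl; rw [hm]; norm_num
      refine ⟨Or.inr (Or.inr (Or.inr ⟨hm, hsq⟩)), fun e => ?_,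
        fun _ hI => absurd hsq (not_isTypeIII_of_isTypeII hI), fun ε' hε' e => ?_,
        fun _ _ => ⟨ε, hε, ?_⟩⟩
      · have := key _ e; norm_num at this
      · have := key _ e; rcases hε' with rfl | rfl <;> norm_num at this
      · exact hform.congr rfl (fun A B => by norm_num) (fun A B => by rw [← neg_smul]; norm_num)

theorem formsSqrtNegOne (h : ActsUnitarily τ₁ τ₂ M l₁ l₃ δ) (h₁ : τ₁.im ≠ 0) (h₂ : τ₂.im ≠ 0)
    (hl₁ : l₁.im ≠ 0) (hl₃ : l₃ ≠ 0) (hIII : IsTypeIII M)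
    (hc : (∃ σ, SignDet l₁ δ σ 0 (1 / 4)) ∨ (∃ σ ε, IsSign ε ∧ SignDet l₁ δ σ ε (1 / 2)) ∨
      ∃ σ ε, SquareDet l₁ δ σ ε (1 / 2)) :
    FormsSqrtNegOne M := by
  rcases hc with ⟨σ, hσ, rfl, hx, hκ⟩ | ⟨σ, ε, hε, hσ, rfl, hx, hκ⟩ | ⟨σ, ε, hσ, hε, hδ, hx, hκ⟩
  · have hx' : l₁ + conj l₁ = 0 := by simpa using hx
    have hform := h.hasBlockForm_of_det_eq_sign_of_trace_eq_zero h₁ h₂ hl₁ hl₃ hIII hσ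
      (by norm_num) hx' hκ
    rcases hσ with rfl | rfl
    · rw [Rat.cast_one] at h
      have hm : minpoly ℚ M = X ^ 2 + 1 := by simpa using h.minpoly_of_det_eq_one h₁ h₂ hl₃ hx
      have key : ∀ p, minpoly ℚ M = p → eval 3 p = 10 := by
        rintro p rfl; rw [hm]; norm_num
      refine ⟨Or.inl hm, fun _ => ?_, fun e => ?_, fun ε hε e => ?_, fun e => ?_, fun ε hε e => ?_,
        fun e => ?_⟩
      · exact hform.congr rfl (fun A B => by rw [← neg_smul]; norm_num) (fun A B => by simp)
      · have := key _ e; norm_num at this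
      · have := key _ e; rcases hε with rfl | rfl <;> norm_num at this
      · have := key _ e; norm_num at this
      · have := key _ e; rcases hε with rfl | rfl <;> norm_num at this
      · have := key _ e; norm_num at this
    · rw [Rat.cast_neg, Rat.cast_one] at h
      have hm : minpoly ℚ M = X ^ 4 - X ^ 2 + 1 := by
        rw [h.minpoly_of_det_eq_neg_one h₁ h₂ hl₁ hl₃ hx hκ]
        norm_num
        ring
      have e := h.sq_of_det_eq_neg_one hx hκ
      have e0 : -((0 : ℚ) : ℂ) * l₁ + (1 - 2 * ((1 / 4 : ℚ) : ℂ)) = (1 / 2 : ℚ) := by norm_num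
      rw [e0] at e
      have hl₃' := mul_ne_zero (sub_conj_ne_zero hl₁) hl₃
      have hsq : IsTypeIII (M ^ 2) := e.isTypeIII h₁ h₂ (by norm_num) hl₃'
      have hι : minpoly ℚ (iotaMat * M ^ 2) = X ^ 2 - 1 := by
        have := e.iota_mul.minpoly_eq_quadratic (a := 0) (b := -1) h₁ h₂ (neg_ne_zero.2 hl₃')
          (by rw [map_ratCast]; simp) (by simp)
        simpa [sub_eq_add_neg] using this
      have key : ∀ p, minpoly ℚ M = p → eval 3 p = 73 := by
        rintro p rfl; rw [hm]; norm_num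
      refine ⟨Or.inr (Or.inl ⟨hm, hsq, hι⟩), fun e => ?_, fun _ _ _ => ?_, fun ε hε e => ?_,
        fun e => ?_, fun ε hε e => ?_, fun _ _ e => ?_⟩
      · have := key _ e; norm_num at this
      · exact hform.congr rfl (fun A B => by norm_num) (fun A B => by simp)
      · have := key _ e; rcases hε with rfl | rfl <;> norm_num at this
      · have := key _ e; norm_num at this
      · have := key _ e; rcases hε with rfl | rfl <;> norm_num at this
      · have := congrArg (eval 3) (hι.symm.trans e); norm_num at this
  · have hform := h.hasBlockForm_of_det_eq_sign h₁ h₂ hl₁ hl₃ hIII hσ (by norm_num) hx hκ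
    rcases hσ with rfl | rfl
    · rw [Rat.cast_one] at h
      have hm := h.minpoly_of_det_eq_one h₁ h₂ hl₃ hx
      have key : ∀ p, minpoly ℚ M = p → eval 3 p = 10 + 3 * ε := by
        rintro p rfl; rw [hm]; norm_num; ring
      refine ⟨Or.inr (Or.inr (Or.inr (Or.inr (Or.inl ⟨ε, hε, hm⟩)))), fun e => ?_, fun e => ?_,
        fun ε' hε' e => ?_, fun e => ?_, fun ε' hε' e => ?_, fun e => ?_⟩
      · have := key _ e; rcases hε with rfl | rfl <;> norm_num at this
      · have := key _ e; rcases hε with rfl | rfl <;> norm_num at this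
      · have := key _ e; rcases hε with rfl | rfl <;> rcases hε' with rfl | rfl <;>
          norm_num at this
      · have := key _ e; rcases hε with rfl | rfl <;> norm_num at this
      · obtain rfl : ε' = ε := by have := key _ e; simp at this; linarith
        exact hform.congr rfl (fun A B => by rw [← neg_smul]; norm_num) (fun A B => by norm_num)
      · have := key _ e; rcases hε with rfl | rfl <;> norm_num at this
    · rw [Rat.cast_neg, Rat.cast_one] at h
      have hm : minpoly ℚ M = X ^ 4 - X ^ 2 + 1 := by
        rw [h.minpoly_of_det_eq_neg_one h₁ h₂ hl₁ hl₃ hx hκ]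
        rcases hε with rfl | rfl <;> norm_num <;> ring
      have e := h.sq_of_det_eq_neg_one hx hκ
      have e1 : -(ε : ℂ) * l₁ + (1 - 2 * ((1 / 2 : ℚ) : ℂ)) = -ε * l₁ := by norm_num
      rw [e1] at e
      have hε2 : (ε : ℂ) ^ 2 = 1 := by rcases hε with rfl | rfl <;> simp
      have hl₁' : (-(ε : ℂ) * l₁).im ≠ 0 := by
        rcases hε with rfl | rfl <;> simpa using hl₁
      have hl₃' := mul_ne_zero (sub_conj_ne_zero hl₁) hl₃
      have hsq : IsTypeIII (M ^ 2) :=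
        e.isTypeIII h₁ h₂ (fun h0 => hl₁' (by rw [h0]; rfl)) hl₃'
      have hι : minpoly ℚ (iotaMat * M ^ 2) = X ^ 4 - X ^ 2 + 1 := by
        have := e.iota_mul.minpoly_of_det_eq_neg_one (x := -1) (κ := 1 / 2) h₁ h₂ hl₁'
          (neg_ne_zero.2 hl₃')
          (by
            simp only [map_mul, map_neg, map_ratCast]
            push_cast
            linear_combination (-ε : ℂ) * hx + hε2)
          (by
            simp only [map_mul, map_neg, map_ratCast]
            rcases hε with rfl | rfl <;> push_cast at hκ ⊢ <;> linear_combination hκ)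
        rw [this]
        norm_num
        ring
      have key : ∀ p, minpoly ℚ M = p → eval 3 p = 73 := by
        rintro p rfl; rw [hm]; norm_num
      refine ⟨Or.inr (Or.inr (Or.inr (Or.inr (Or.inr ⟨hm, hsq, hι⟩)))), fun e => ?_,
        fun _ _ e => ?_, fun ε' hε' e => ?_, fun e => ?_, fun ε' hε' e => ?_,
        fun _ _ _ => ⟨ε, hε, ?_⟩⟩
      · have := key _ e; norm_num at this
      · have := congrArg (eval 3) (hι.symm.trans e); norm_num at this
      · have := key _ e; rcases hε' with rfl | rfl <;> norm_num at this
      · have := key _ e; norm_num at this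
      · have := key _ e; rcases hε' with rfl | rfl <;> norm_num at this
      · exact hform.congr rfl (fun A B => by norm_num) (fun A B => by rw [← neg_smul]; norm_num)
  · have hform := h.hasBlockForm_of_det_eq_sq_div h₁ h₂ hl₁ hl₃ hIII hσ (by norm_num)
      (by norm_num) hx hκ hδ
    rcases hσ with rfl | rfl
    · have hm : minpoly ℚ M = X ^ 3 + C ε * X ^ 2 + X + C ε := by
        rw [h.minpoly_of_det_eq_sq_div h₁ h₂ hl₁ hl₃ hε (by norm_num) hx hκ (by simpa using hδ)]
        norm_num
      have key : ∀ p, minpoly ℚ M = p → eval 3 p = 30 + 10 * ε := by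
        rintro p rfl; rw [hm]; norm_num; ring
      refine ⟨Or.inr (Or.inr (Or.inl ⟨ε, hε, hm⟩)), fun e => ?_, fun e => ?_, fun ε' hε' e => ?_,
        fun e => ?_, fun ε' hε' e => ?_, fun e => ?_⟩
      · have := key _ e; rcases hε with rfl | rfl <;> norm_num at this
      · have := key _ e; rcases hε with rfl | rfl <;> norm_num at this
      · obtain rfl : ε' = ε := by have := key _ e; simp at this; linarith
        exact hform.congr (by ring_nf) (fun A B => by norm_num) (fun A B => by simp)
      · have := key _ e; rcases hε with rfl | rfl <;> norm_num at this
      · have := key _ e; rcases hε with rfl | rfl <;> rcases hε' with rfl | rfl <;>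
          norm_num at this
      · have := key _ e; rcases hε with rfl | rfl <;> norm_num at this
    · obtain ⟨hm, hsq⟩ := h.minpoly_of_det_eq_neg_sq_div h₁ h₂ hl₁ hl₃ hε (by norm_num) hx hκ
        (by simpa using hδ)
      have hm : minpoly ℚ M = X ^ 4 + 1 := by rw [hm]; norm_num
      have hnot := not_isTypeIII_of_isTypeI hsq
      have key : ∀ p, minpoly ℚ M = p → eval 3 p = 82 := by
        rintro p rfl; rw [hm]; norm_num
      refine ⟨Or.inr (Or.inr (Or.inr (Or.inl ⟨hm, hsq⟩))), fun e => ?_,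
        fun _ hI => absurd hI hnot, fun ε' hε' e => ?_,
        fun _ _ => ⟨ε, hε, ?_⟩, fun ε' hε' e => ?_, fun _ hI => absurd hI hnot⟩
      · have := key _ e; norm_num at this
      · have := key _ e; rcases hε' with rfl | rfl <;> norm_num at this
      · exact hform.congr (by ring_nf) (fun A B => by norm_num) (fun A B => by simp)
      · have := key _ e; rcases hε' with rfl | rfl <;> norm_num at this

end ActsUnitarily

/-! ### Integrality and the classification of the multipliers -/

theorem exists_int_of_isIntegral_ratCast {q : ℚ} (h : IsIntegral ℤ (q : ℂ)) : ∃ n : ℤ, q = n := by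
  have h' : IsIntegral ℤ (algebraMap ℚ ℂ q) := h
  rw [isIntegral_algebraMap_iff (algebraMap ℚ ℂ).injective, IsIntegrallyClosed.isIntegral_iff] at h'
  obtain ⟨n, hn⟩ := h'
  exact ⟨n, by simpa using hn.symm⟩

/-- The eigenvalues of a matrix of finite order are roots of unity. -/
theorem Matrix.isIntegral_of_mem_roots_charpoly {k : Type*} [Fintype k] [DecidableEq k]
    {m : Matrix k k ℂ} {n : ℕ} (hn : 0 < n) (hm : m ^ n = 1) {μ : ℂ}
    (hμ : μ ∈ m.charpoly.roots) : IsIntegral ℤ μ := by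
  have h1 := Matrix.mem_spectrum_iff_isRoot_charpoly.2 (isRoot_of_mem_roots hμ)
  have h2 := spectrum.pow_mem_pow m n h1
  have : Nontrivial (Matrix k k ℂ) := by
    rcases isEmpty_or_nonempty k with h | h
    · simp at hμ
    · infer_instance
  rw [hm, spectrum.one_eq, Set.mem_singleton_iff] at h2
  exact IsIntegral.of_pow hn (h2 ▸ isIntegral_one)

theorem Matrix.isIntegral_trace_of_pow_eq_one {k : Type*} [Fintype k] [DecidableEq k]
    {m : Matrix k k ℂ} {n : ℕ} (hn : 0 < n) (hm : m ^ n = 1) : IsIntegral ℤ m.trace := by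
  rw [m.trace_eq_sum_roots_charpoly]
  exact IsIntegral.multiset_sum fun μ hμ => isIntegral_of_mem_roots_charpoly hn hm hμ

theorem Matrix.isIntegral_det_of_pow_eq_one {k : Type*} [Fintype k] [DecidableEq k]
    {m : Matrix k k ℂ} {n : ℕ} (hn : 0 < n) (hm : m ^ n = 1) : IsIntegral ℤ m.det := by
  rw [m.det_eq_prod_roots_charpoly]
  exact IsIntegral.multiset_prod fun μ hμ => isIntegral_of_mem_roots_charpoly hn hm hμ

/-- The only squares of rationals among `0, 1, 2, 3` are `0` and `1`. -/
theorem sq_eq_int_cases {q : ℚ} {j : ℤ} (h : q ^ 2 = j) (hj : j ≤ 3) :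
    (j = 0 ∧ q = 0) ∨ (j = 1 ∧ (q = 1 ∨ q = -1)) := by
  have h0 : 0 ≤ j := by
    have : (0 : ℚ) ≤ j := h ▸ sq_nonneg q
    exact_mod_cast this
  have hs : IsSquare (j : ℚ) := ⟨q, by rw [← h, sq]⟩
  interval_cases j
  · left; simpa using h
  · right; simpa using h
  · norm_num at hs
  · norm_num at hs

theorem two_mul_sq_eq_int_cases {q : ℚ} {j : ℤ} (h : 2 * q ^ 2 = j) (hj : j ≤ 3) :
    (j = 0 ∧ q = 0) ∨ (j = 2 ∧ (q = 1 ∨ q = -1)) := by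
  have h0 : 0 ≤ j := by
    have : (0 : ℚ) ≤ j := by rw [← h]; positivity
    exact_mod_cast this
  have hs : IsSquare ((j : ℚ) / 2) := ⟨q, by rw [← h]; ring⟩
  interval_cases j
  · left; simpa using h
  · norm_num at hs
  · right; simpa using h
  · norm_num at hs

theorem three_mul_sq_eq_int_cases {q : ℚ} {j : ℤ} (h : 3 * q ^ 2 = j) (hj : j ≤ 3) :
    (j = 0 ∧ q = 0) ∨ (j = 3 ∧ (q = 1 ∨ q = -1)) := by
  have h0 : 0 ≤ j := by
    have : (0 : ℚ) ≤ j := by rw [← h]; positivity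
    exact_mod_cast this
  have hs : IsSquare ((j : ℚ) / 3) := ⟨q, by rw [← h]; ring⟩
  interval_cases j
  · left; simpa using h
  · norm_num at hs
  · norm_num at hs
  · right; simpa using h

/-! The next four lemmas solve, over `ℚ`, the condition that `n = |t|²` be an integer.  In each of
them `n` and `k - n`, where `k = 4κ ∈ {1, 2, 3}`, are a constant times a rational square. -/

/-- The case `δ = z = ±1`. -/
theorem rat_cases_of_sign {x y κ D z : ℚ} {k n : ℤ} (hD : 0 < D) (hκ : 4 * κ = k)
    (hk3 : k ≤ 3) (hxy : x ^ 2 + D * y ^ 2 = κ) (hz : IsSign z)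
    (hn : 2 * κ + 2 * (z * (x ^ 2 - D * y ^ 2)) = n) : x = 0 ∨ x = 1 / 2 ∨ x = -1 / 2 := by
  have h4 : ∃ j : ℤ, (2 * x) ^ 2 = j := by
    rcases hz with rfl | rfl
    · exact ⟨n, by linear_combination hn + 2 * hxy⟩
    · exact ⟨k - n, by push_cast; linear_combination 2 * hxy + hκ - hn⟩
  obtain ⟨j, hj⟩ := h4
  have hj3 : j ≤ 3 := by
    have : (j : ℚ) ≤ k := by rw [← hj]; nlinarith [mul_nonneg hD.le (sq_nonneg y)]
    exact (Int.cast_le.1 this).trans hk3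
  rcases sq_eq_int_cases hj hj3 with ⟨-, h⟩ | ⟨-, h | h⟩
  · left; linarith
  · right; left; linarith
  · right; right; linarith

/-- The case `δ = w θ`, `(w θ)² = -1`, `l₁ = x + v w θ`. -/
theorem rat_cases_of_order_four {x v κ : ℚ} {k n : ℤ} (hκ : 4 * κ = k)
    (hk1 : 1 ≤ k) (hk3 : k ≤ 3) (hxv : x ^ 2 + v ^ 2 = κ) (hn : 2 * κ + 4 * x * v = n) :
    κ = 1 / 2 ∧ (x = 1 / 2 ∨ x = -1 / 2) ∧ (v = x ∨ v = -x) := by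
  have e1 : 2 * (x + v) ^ 2 = n := by linear_combination hn + 2 * hxv
  have e2 : 2 * (x - v) ^ 2 = (k - n : ℤ) := by
    push_cast; linear_combination hκ - hn + 2 * hxv
  have hn0 : 0 ≤ n := by
    have : (0 : ℚ) ≤ n := by rw [← e1]; positivity
    exact_mod_cast this
  have hn3 : 0 ≤ k - n := by
    have : (0 : ℚ) ≤ (k - n : ℤ) := by rw [← e2]; positivity
    exact_mod_cast this
  rcases two_mul_sq_eq_int_cases e1 (by omega) with ⟨hn, h⟩ | ⟨hn, h⟩ <;>
    rcases two_mul_sq_eq_int_cases e2 (by omega) with ⟨hn', h'⟩ | ⟨hn', h'⟩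
  · omega
  · obtain rfl : k = 2 := by omega
    refine ⟨by norm_num at hκ; linarith, ?_, Or.inr (by linarith)⟩
    rcases h' with h' | h'
    · left; linarith
    · right; linarith
  · obtain rfl : k = 2 := by omega
    refine ⟨by norm_num at hκ; linarith, ?_, Or.inl (by linarith)⟩
    rcases h with h | h
    · left; linarith
    · right; linarith
  · omega

/-- The case `δ = 1 / 2 + w θ`, `(2 w θ)² = -3`, `l₁ = x + 2 v w θ`. -/
theorem rat_cases_of_order_six {x v κ : ℚ} {k n : ℤ} (hκ : 4 * κ = k)
    (hk1 : 1 ≤ k) (hk3 : k ≤ 3) (hxv : x ^ 2 + 3 * v ^ 2 = κ)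
    (hn : 2 * κ + (x ^ 2 - 3 * v ^ 2) + 6 * x * v = n) :
    (κ = 1 / 4 ∧ (x = κ ∨ x = -κ) ∧ v = -x) ∨ (κ = 3 / 4 ∧ (x = κ ∨ x = -κ) ∧ 3 * v = x) := by
  have e1 : 3 * (x + v) ^ 2 = n := by linear_combination hn + 2 * hxv
  have e2 : (x - 3 * v) ^ 2 = (k - n : ℤ) := by
    push_cast; linear_combination hκ - hn + 2 * hxv
  have hn0 : 0 ≤ n := by
    have : (0 : ℚ) ≤ n := by rw [← e1]; positivity
    exact_mod_cast this
  have hn3 : 0 ≤ k - n := by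
    have : (0 : ℚ) ≤ (k - n : ℤ) := by rw [← e2]; positivity
    exact_mod_cast this
  rcases three_mul_sq_eq_int_cases e1 (by omega) with ⟨hn, h⟩ | ⟨hn, h⟩ <;>
    rcases sq_eq_int_cases e2 (by omega) with ⟨hn', h'⟩ | ⟨hn', h'⟩
  · omega
  · obtain rfl : k = 1 := by omega
    norm_num at hκ
    refine Or.inl ⟨by linarith, ?_, by linarith⟩
    rcases h' with h' | h'
    · left; linarith
    · right; linarith
  · obtain rfl : k = 3 := by omega
    norm_num at hκ
    refine Or.inr ⟨by linarith, ?_, by linarith⟩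
    rcases h with h | h
    · left; linarith
    · right; linarith
  · omega

/-- The case `δ = -1 / 2 + w θ`, `(2 w θ)² = -3`, `l₁ = x + 2 v w θ`. -/
theorem rat_cases_of_order_three {x v κ : ℚ} {k n : ℤ} (hκ : 4 * κ = k)
    (hk1 : 1 ≤ k) (hk3 : k ≤ 3) (hxv : x ^ 2 + 3 * v ^ 2 = κ)
    (hn : 2 * κ - (x ^ 2 - 3 * v ^ 2) + 6 * x * v = n) :
    (κ = 1 / 4 ∧ (x = κ ∨ x = -κ) ∧ v = x) ∨ (κ = 3 / 4 ∧ (x = κ ∨ x = -κ) ∧ 3 * v = -x) := by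
  have e1 : (x + 3 * v) ^ 2 = n := by linear_combination hn + 2 * hxv
  have e2 : 3 * (x - v) ^ 2 = (k - n : ℤ) := by
    push_cast; linear_combination hκ - hn + 2 * hxv
  have hn0 : 0 ≤ n := by
    have : (0 : ℚ) ≤ n := by rw [← e1]; positivity
    exact_mod_cast this
  have hn3 : 0 ≤ k - n := by
    have : (0 : ℚ) ≤ (k - n : ℤ) := by rw [← e2]; positivity
    exact_mod_cast this
  rcases sq_eq_int_cases e1 (by omega) with ⟨hn, h⟩ | ⟨hn, h⟩ <;>
    rcases three_mul_sq_eq_int_cases e2 (by omega) with ⟨hn', h'⟩ | ⟨hn', h'⟩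
  · omega
  · obtain rfl : k = 3 := by omega
    norm_num at hκ
    refine Or.inr ⟨by linarith, ?_, by linarith⟩
    rcases h' with h' | h'
    · left; linarith
    · right; linarith
  · obtain rfl : k = 1 := by omega
    norm_num at hκ
    refine Or.inl ⟨by linarith, ?_, by linarith⟩
    rcases h with h | h
    · left; linarith
    · right; linarith
  · omega

/-- The possible pairs `(l₁, δ)` in `ℚ(√-D)`, where `l₁` has norm `κ` and `√-D`-coordinate `y`, and
`w` is the `√-D`-coordinate of `δ`: either `δ` is a sign and `l₁` has trace `0` or `±1`, or
`δ = ±l₁² / |l₁|²` is a non-real root of unity of order 4, or of order 3 or 6.  The equations for `y`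
and `w` determine the field. -/
def MultiplierCases (l₁ δ : ℂ) (D y w κ : ℚ) : Prop :=
  (∃ σ, SignDet l₁ δ σ 0 κ ∧ D * (2 * y) ^ 2 = 4 * κ) ∨
  (∃ σ ε, IsSign ε ∧ SignDet l₁ δ σ ε κ ∧ D * (2 * y) ^ 2 = 4 * κ - 1) ∨
  (∃ σ ε, SquareDet l₁ δ σ ε κ ∧
    ((κ = 1 / 2 ∧ D * w ^ 2 = 1) ∨ ((κ = 1 / 4 ∨ κ = 3 / 4) ∧ D * (2 * w) ^ 2 = 3)))

/-- The determinant `δ` and the trace `t = l₁ + δ l̄₁` are algebraic integers in `ℚ(θ)`, so `2 Re δ` and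
`|t|²` are integers; this leaves the listed cases. -/
theorem multiplierCases_of_isIntegral {θ l₁ δ : ℂ} {D x y z w κ : ℚ} (hθ : θ ^ 2 = -D)
    (hθc : conj θ = -θ)
    (hD : 0 < D) (hl : l₁ = x + y * θ) (hd : δ = z + w * θ) (hδ : δ * conj δ = 1)
    (hκ : l₁ * conj l₁ = κ) (hκ' : κ = 1 / 4 ∨ κ = 1 / 2 ∨ κ = 3 / 4)
    (hδi : IsIntegral ℤ δ) (hti : IsIntegral ℤ (l₁ + δ * conj l₁)) :
    MultiplierCases l₁ δ D y w κ := by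
  have hlc : conj l₁ = x - y * θ := by
    rw [hl, map_add, map_mul, map_ratCast, map_ratCast, hθc]; ring
  have hdc : conj δ = z - w * θ := by
    rw [hd, map_add, map_mul, map_ratCast, map_ratCast, hθc]; ring
  have hxy : x ^ 2 + D * y ^ 2 = κ := by
    rw [hlc, hl] at hκ
    have : ((x ^ 2 + D * y ^ 2 : ℚ) : ℂ) = (κ : ℚ) := by
      push_cast; linear_combination hκ + (y : ℂ) ^ 2 * hθ
    exact_mod_cast this
  have hzw : z ^ 2 + D * w ^ 2 = 1 := by
    rw [hdc, hd] at hδ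
    have : ((z ^ 2 + D * w ^ 2 : ℚ) : ℂ) = (1 : ℚ) := by
      push_cast; linear_combination hδ + (w : ℂ) ^ 2 * hθ
    exact_mod_cast this
  obtain ⟨c, hc⟩ : ∃ c : ℤ, 2 * z = c := by
    refine exists_int_of_isIntegral_ratCast ?_
    have := hδi.add (map_isIntegral_int (starRingEnd ℂ) hδi)
    have e : ((2 * z : ℚ) : ℂ) = δ + conj δ := by rw [hdc, hd]; push_cast; ring
    rwa [e]
  obtain ⟨n, hn⟩ : ∃ n : ℤ, 2 * κ + 2 * (z * (x ^ 2 - D * y ^ 2)) + 4 * (x * y * (D * w)) = n := by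
    refine exists_int_of_isIntegral_ratCast ?_
    have := hti.mul (map_isIntegral_int (starRingEnd ℂ) hti)
    rw [map_add, map_mul, Complex.conj_conj] at this
    have e1 : l₁ ^ 2 = x ^ 2 - D * y ^ 2 + 2 * x * y * θ := by
      rw [hl]; linear_combination (y : ℂ) ^ 2 * hθ
    have e2 : conj l₁ ^ 2 = x ^ 2 - D * y ^ 2 - 2 * x * y * θ := by
      rw [hlc]; linear_combination (y : ℂ) ^ 2 * hθ
    -- `|t|² = 2κ + 2 Re (δ̄ l₁²)`, because `|δ| = 1`
    have e : (l₁ + δ * conj l₁) * (conj l₁ + conj δ * l₁) =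
        l₁ * conj l₁ * (1 + δ * conj δ) + conj δ * l₁ ^ 2 + δ * conj l₁ ^ 2 := by ring
    rw [e, hδ, hκ, e1, e2, hdc, hd] at this
    refine cast (congrArg (IsIntegral ℤ) ?_) this
    push_cast
    linear_combination (-4) * (x * y * w : ℂ) * hθ
  obtain ⟨k, hk, hk1, hk3⟩ : ∃ k : ℤ, 4 * κ = k ∧ 1 ≤ k ∧ k ≤ 3 := by
    rcases hκ' with rfl | rfl | rfl
    · exact ⟨1, by norm_num⟩
    · exact ⟨2, by norm_num⟩
    · exact ⟨3, by norm_num⟩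
  have hadd : l₁ + conj l₁ = 2 * x := by rw [hlc, hl]; ring
  have hc2 : -2 ≤ c ∧ c ≤ 2 := by
    have h1 : z ^ 2 ≤ 1 := by nlinarith [mul_nonneg hD.le (sq_nonneg w)]
    have h2 := abs_le.1 ((sq_le_one_iff_abs_le_one z).1 h1)
    constructor
    · have : ((-2 : ℤ) : ℚ) ≤ c := by rw [← hc]; push_cast; linarith
      exact_mod_cast this
    · have : (c : ℚ) ≤ (2 : ℤ) := by rw [← hc]; push_cast; linarith
      exact_mod_cast this
  have hsign : IsSign z → (∃ σ, SignDet l₁ δ σ 0 κ ∧ D * (2 * y) ^ 2 = 4 * κ) ∨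
      (∃ σ ε, IsSign ε ∧ SignDet l₁ δ σ ε κ ∧ D * (2 * y) ^ 2 = 4 * κ - 1) := by
    intro hz
    have hz2 : z ^ 2 = 1 := by rcases hz with rfl | rfl <;> norm_num
    have hw : w = 0 := by
      have : D * w ^ 2 = 0 := by linarith
      simpa [hD.ne'] using this
    have hdz : δ = z := by rw [hd, hw]; simp
    subst hw
    rcases rat_cases_of_sign hD hk hk3 hxy hz (by linear_combination hn) with rfl | rfl | rfl
    · exact Or.inl ⟨z, ⟨hz, hdz, by simpa using hadd, hκ⟩, by linear_combination 4 * hxy⟩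
    · exact Or.inr ⟨z, -1, Or.inr rfl, ⟨hz, hdz, by rw [hadd]; norm_num, hκ⟩,
        by linear_combination 4 * hxy⟩
    · exact Or.inr ⟨z, 1, Or.inl rfl, ⟨hz, hdz, by rw [hadd]; norm_num, hκ⟩,
        by linear_combination 4 * hxy⟩
  have hthree : D * (2 * w) ^ 2 = 3 → ∃ v, y = v * (2 * w) ∧ x ^ 2 + 3 * v ^ 2 = κ ∧
      x * y * (D * w) = 3 / 2 * x * v ∧ D * y ^ 2 = 3 * v ^ 2 := by
    intro hw3
    have hw0 : w ≠ 0 := by rintro rfl; norm_num at hw3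
    have hy : y = y / (2 * w) * (2 * w) := by field_simp
    refine ⟨y / (2 * w), hy, ?_⟩
    generalize y / (2 * w) = v at hy
    subst hy
    exact ⟨by linear_combination hxy - v ^ 2 * hw3, by linear_combination x * v / 2 * hw3,
      by linear_combination v ^ 2 * hw3⟩
  obtain ⟨hc2, hc2'⟩ := hc2
  -- for non-real `δ`, `l₁` has trace `-2εκ`, and it remains to compare `δ κ` with `σ l₁²`
  have hkey : ∀ σ ε : ℚ, IsSign σ → IsSign ε → x = -(ε * κ) →
      (z + w * θ) * κ = σ * (x + y * θ) ^ 2 →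
      SquareDet l₁ δ σ ε κ := by
    intro σ ε hσ hε hx h
    have hκ0 : (κ : ℂ) ≠ 0 := by
      have : κ ≠ 0 := by rcases hκ' with rfl | rfl | rfl <;> norm_num
      exact_mod_cast this
    refine ⟨hσ, hε, ?_, by rw [hadd, hx]; push_cast; ring, hκ⟩
    field_simp
    rw [hd, hl]
    exact h
  -- `c = 2 Re δ` runs through `-2, -1, 0, 1, 2`
  interval_cases c
  · rcases hsign (Or.inr (by push_cast at hc; linarith)) with h | h
    · exact Or.inl h
    · exact Or.inr (Or.inl h)
  · obtain rfl : z = -1 / 2 := by push_cast at hc; linarith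
    have hw3 : D * (2 * w) ^ 2 = 3 := by linear_combination 4 * hzw
    have hwθ : ((w : ℂ) * θ) ^ 2 = -(3 / 4) := by
      have : ((D * (2 * w) ^ 2 : ℚ) : ℂ) = (3 : ℚ) := by rw [hw3]
      push_cast at this
      linear_combination (w : ℂ) ^ 2 * hθ - this / 4
    obtain ⟨v, rfl, hxv, e1, e2⟩ := hthree hw3
    refine Or.inr (Or.inr ?_)
    rcases rat_cases_of_order_three hk hk1 hk3 hxv (by linear_combination hn - 4 * e1 - e2) with
      ⟨rfl, hx, rfl⟩ | ⟨rfl, hx, hv⟩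
    · refine ⟨1, _, hkey 1 (-(4 * v)) (Or.inl rfl) ?_ (by ring) ?_, Or.inr ⟨Or.inl rfl, hw3⟩⟩
      · rcases hx with rfl | rfl <;> norm_num [IsSign]
      · rcases hx with rfl | rfl <;> push_cast <;> linear_combination (-(1 / 4) : ℂ) * hwθ
    · obtain rfl : x = -3 * v := by linarith
      refine ⟨-1, _, hkey (-1) (4 * v) (Or.inr rfl) ?_ (by ring) ?_, Or.inr ⟨Or.inr rfl, hw3⟩⟩
      · rcases hx with hx | hx
        · right; linarith
        · left; linarith
      · have hv2 : (v : ℂ) ^ 2 = 1 / 16 := by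
          rcases hx with hx | hx
          · obtain rfl : v = -1 / 4 := by linarith
            norm_num
          · obtain rfl : v = 1 / 4 := by linarith
            norm_num
        push_cast
        linear_combination (9 - 12 * w * θ + 4 * (w * θ) ^ 2) * hv2 + (1 / 4) * hwθ
  · obtain rfl : z = 0 := by push_cast at hc; linarith
    have hw1 : D * w ^ 2 = 1 := by linear_combination hzw
    have hwθ : ((w : ℂ) * θ) ^ 2 = -1 := by
      have : ((D * w ^ 2 : ℚ) : ℂ) = (1 : ℚ) := by rw [hw1]
      push_cast at this
      linear_combination (w : ℂ) ^ 2 * hθ - this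
    have hw0 : w ≠ 0 := by rintro rfl; norm_num at hw1
    have hy : y = y / w * w := by field_simp
    generalize y / w = v at hy
    subst hy
    refine Or.inr (Or.inr ?_)
    obtain ⟨rfl, hx, hv⟩ := rat_cases_of_order_four (x := x) (v := v) hk hk1 hk3
      (by linear_combination hxy - v ^ 2 * hw1) (by linear_combination hn - 4 * x * v * hw1)
    have hε : IsSign (-(2 * x)) := by
      rcases hx with rfl | rfl <;> norm_num [IsSign]
    have hx2 : (x : ℂ) ^ 2 = 1 / 4 := by
      rcases hx with rfl | rfl <;> norm_num
    rcases hv with rfl | rfl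
    · refine ⟨1, _, hkey 1 _ (Or.inl rfl) hε (by ring) ?_, Or.inl ⟨rfl, hw1⟩⟩
      push_cast
      linear_combination -(1 + w * θ) ^ 2 * hx2 - (1 / 4) * hwθ
    · refine ⟨-1, _, hkey (-1) _ (Or.inr rfl) hε (by ring) ?_, Or.inl ⟨rfl, hw1⟩⟩
      push_cast
      linear_combination (1 - w * θ) ^ 2 * hx2 + (1 / 4) * hwθ
  · obtain rfl : z = 1 / 2 := by push_cast at hc; linarith
    have hw3 : D * (2 * w) ^ 2 = 3 := by linear_combination 4 * hzw
    have hwθ : ((w : ℂ) * θ) ^ 2 = -(3 / 4) := by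
      have : ((D * (2 * w) ^ 2 : ℚ) : ℂ) = (3 : ℚ) := by rw [hw3]
      push_cast at this
      linear_combination (w : ℂ) ^ 2 * hθ - this / 4
    obtain ⟨v, rfl, hxv, e1, e2⟩ := hthree hw3
    refine Or.inr (Or.inr ?_)
    rcases rat_cases_of_order_six hk hk1 hk3 hxv (by linear_combination hn - 4 * e1 + e2) with
      ⟨rfl, hx, rfl⟩ | ⟨rfl, hx, rfl⟩
    · refine ⟨-1, _, hkey (-1) (-(4 * x)) (Or.inr rfl) ?_ (by ring) ?_,
        Or.inr ⟨Or.inl rfl, hw3⟩⟩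
      · rcases hx with rfl | rfl <;> norm_num [IsSign]
      · rcases hx with rfl | rfl <;> push_cast <;> linear_combination (1 / 4 : ℂ) * hwθ
    · refine ⟨1, _, hkey 1 (-(4 * v)) (Or.inl rfl) ?_ (by ring) ?_, Or.inr ⟨Or.inr rfl, hw3⟩⟩
      · rcases hx with hx | hx
        · right; linarith
        · left; linarith
      · have hv2 : (v : ℂ) ^ 2 = 1 / 16 := by
          rcases hx with hx | hx
          · obtain rfl : v = 1 / 4 := by linarith
            norm_num
          · obtain rfl : v = -1 / 4 := by linarith
            norm_num
        push_cast
        linear_combination -(9 + 12 * w * θ + 4 * (w * θ) ^ 2) * hv2 - (1 / 4) * hwθ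
  · rcases hsign (Or.inl (by push_cast at hc; linarith)) with h | h
    · exact Or.inl h
    · exact Or.inr (Or.inl h)

/-! ### Imaginary quadratic fields and the norm of the first multiplier -/

/-- The square root `√D · i` of `-D`. -/
noncomputable def sqrtNeg (D : ℚ) : ℂ := ((Real.sqrt D : ℝ) : ℂ) * Complex.I

theorem sqrtNeg_sq {D : ℚ} (hD : 0 < D) : sqrtNeg D ^ 2 = -D := by
  have h : (Real.sqrt D) ^ 2 = D := Real.sq_sqrt (by exact_mod_cast hD.le)
  rw [sqrtNeg, mul_pow, Complex.I_sq, ← Complex.ofReal_pow, h]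
  simp

theorem conj_sqrtNeg (D : ℚ) : conj (sqrtNeg D) = -sqrtNeg D := by
  simp [sqrtNeg]

theorem sqrtNeg_im_ne_zero {D : ℚ} (hD : 0 < D) : (sqrtNeg D).im ≠ 0 := by
  have : (0 : ℝ) < D := by exact_mod_cast hD
  simpa [sqrtNeg] using (Real.sqrt_pos.2 this).ne'

/-- A quadratic field containing a non-real number is `ℚ(√-D)` for some rational `D > 0`. -/
theorem exists_rat_coords {K : IntermediateField ℚ ℂ} (hK : Module.finrank ℚ K = 2) {τ : ℂ}
    (hτ : τ ∈ K) (him : 0 < τ.im) :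
    ∃ D : ℚ, 0 < D ∧ ∀ z ∈ K, ∃ x y : ℚ, z = x + y * sqrtNeg D := by
  have hli : LinearIndependent ℚ ![(1 : K), ⟨τ, hτ⟩] := by
    rw [LinearIndependent.pair_iff]
    intro a b hab
    have h := congrArg (Subtype.val) hab
    exact rat_add_rat_mul_eq_zero him.ne' (by simpa [Algebra.smul_def] using h)
  have hspan := hli.span_eq_top_of_card_eq_finrank (by simp [hK])
  have hcoord : ∀ z ∈ K, ∃ a b : ℚ, z = a + b * τ := by
    intro z hz
    have hm : (⟨z, hz⟩ : K) ∈ Submodule.span ℚ (Set.range ![(1 : K), ⟨τ, hτ⟩]) := by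
      rw [hspan]; trivial
    rw [Matrix.range_cons, Matrix.range_cons, Matrix.range_empty, Set.union_empty,
      Set.singleton_union, Submodule.mem_span_pair] at hm
    obtain ⟨a, b, hab⟩ := hm
    have h := congrArg Subtype.val hab
    exact ⟨a, b, by simpa [Algebra.smul_def] using h.symm⟩
  obtain ⟨a, b, hab⟩ := hcoord (τ ^ 2) (pow_mem hτ 2)
  have hi := congrArg Complex.im hab
  have hr := congrArg Complex.re hab
  simp [sq] at hi hr
  have hre : τ.re = b / 2 := by
    apply mul_right_cancel₀ him.ne'
    linarith
  rw [hre] at hr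
  have hD : ((-a - b ^ 2 / 4 : ℚ) : ℝ) = τ.im ^ 2 := by
    push_cast; linarith
  have hpos : 0 < -a - b ^ 2 / 4 := by
    have : (0 : ℝ) < ((-a - b ^ 2 / 4 : ℚ) : ℝ) := by rw [hD]; positivity
    exact_mod_cast this
  refine ⟨_, hpos, fun z hz => ?_⟩
  obtain ⟨x, y, rfl⟩ := hcoord z hz
  refine ⟨x + y * b / 2, y, ?_⟩
  rw [sqrtNeg, hD, Real.sqrt_sq him.le]
  apply Complex.ext
  · simp [hre]; ring
  · simp

theorem imagQuadField_coords {d : ℕ} (hd : 0 < d) {z : ℂ} (hz : z ∈ imagQuadField d) :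
    ∃ x y : ℚ, z = x + y * sqrtNeg d := by
  have hθ : sqrtNeg (d : ℚ) ^ 2 = -((d : ℚ) : ℂ) := sqrtNeg_sq (by exact_mod_cast hd)
  induction hz using IntermediateField.adjoin_induction with
  | mem x hx =>
    rw [Set.mem_singleton_iff] at hx
    exact ⟨0, 1, by simp [hx, sqrtNeg]⟩
  | algebraMap q => exact ⟨q, 0, by simp⟩
  | add u v _ _ hu hv =>
    obtain ⟨a, b, rfl⟩ := hu
    obtain ⟨a', b', rfl⟩ := hv
    exact ⟨a + a', b + b', by push_cast; ring⟩
  | inv u _ hu =>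
    obtain ⟨a, b, rfl⟩ := hu
    by_cases h0 : (a : ℂ) + b * sqrtNeg d = 0
    · exact ⟨0, 0, by simp [h0]⟩
    have hn : (a : ℂ) ^ 2 + d * b ^ 2 ≠ 0 := by
      intro h
      have h' : a ^ 2 + d * b ^ 2 = 0 := by exact_mod_cast h
      have hdb : (0 : ℚ) ≤ d * b ^ 2 := by positivity
      have ha : a = 0 := pow_eq_zero_iff (two_ne_zero) |>.1 (by linarith [sq_nonneg a])
      have hb : b = 0 := by
        have hd' : (d : ℚ) ≠ 0 := by exact_mod_cast hd.ne'
        simpa [ha, hd'] using h'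
      exact h0 (by simp [ha, hb])
    refine ⟨a / (a ^ 2 + d * b ^ 2), -b / (a ^ 2 + d * b ^ 2), inv_eq_of_mul_eq_one_right ?_⟩
    push_cast at hθ ⊢
    rw [← div_self hn]
    linear_combination (-(b : ℂ) ^ 2 / (a ^ 2 + d * b ^ 2)) * hθ
  | mul u v _ _ hu hv =>
    obtain ⟨a, b, rfl⟩ := hu
    obtain ⟨a', b', rfl⟩ := hv
    exact ⟨a * a' - d * b * b', a * b' + b * a', by
      push_cast at hθ ⊢; linear_combination (b * b' : ℂ) * hθ⟩

/-- If `D q² = d` then `ℚ(√-D) = ℚ(√-d)`. -/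
theorem mem_imagQuadField {D q : ℚ} {d : ℕ} (hD : 0 < D) (hd : 0 < d) (hq : D * q ^ 2 = d) {z : ℂ}
    (hz : ∃ x y : ℚ, z = x + y * sqrtNeg D) : z ∈ imagQuadField d := by
  obtain ⟨x, y, rfl⟩ := hz
  have hq0 : q ≠ 0 := by
    rintro rfl
    have : (d : ℚ) ≠ 0 := by exact_mod_cast hd.ne'
    exact this (by simpa using hq.symm)
  have hgen : ((Real.sqrt d : ℝ) : ℂ) * Complex.I ∈ imagQuadField d :=
    IntermediateField.mem_adjoin_simple_self ℚ _
  have e : sqrtNeg D = ((|q|⁻¹ : ℚ) : ℂ) * (((Real.sqrt d : ℝ) : ℂ) * Complex.I) := by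
    have : (d : ℝ) = D * (q : ℝ) ^ 2 := by exact_mod_cast hq.symm
    have hD' : (0 : ℝ) ≤ D := by exact_mod_cast hD.le
    have hq' : |(q : ℝ)| ≠ 0 := by simpa using hq0
    have h2 : Real.sqrt D = ((|q|⁻¹ : ℚ) : ℝ) * Real.sqrt d := by
      rw [this, Real.sqrt_mul hD', Real.sqrt_sq_eq_abs]
      push_cast
      field_simp
    rw [sqrtNeg, h2, Complex.ofReal_mul, Complex.ofReal_ratCast, mul_assoc]
  rw [e]
  exact add_mem (SubfieldClass.ratCast_mem _ _)
    (mul_mem (SubfieldClass.ratCast_mem _ _) (mul_mem (SubfieldClass.ratCast_mem _ _) hgen))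

theorem map_mul_intertwines {P : Matrix Coord (Fin 2) ℂ} {A B : Mat4}
    {a b : Matrix (Fin 2) (Fin 2) ℂ}
    (hA : A.map (algebraMap ℚ ℂ) * P = P * a) (hB : B.map (algebraMap ℚ ℂ) * P = P * b) :
    (A * B).map (algebraMap ℚ ℂ) * P = P * (a * b) := by
  rw [Matrix.map_mul, Matrix.mul_assoc, hB, ← Matrix.mul_assoc, hA, Matrix.mul_assoc]

theorem pow_eq_one_of_intertwines {τ₁ τ₂ : ℂ} (h₁ : τ₁.im ≠ 0) (h₂ : τ₂.im ≠ 0) {M : Mat4}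
    {m : Matrix (Fin 2) (Fin 2) ℂ}
    (h : M.map (algebraMap ℚ ℂ) * tangentBasis τ₁ τ₂ = tangentBasis τ₁ τ₂ * m) {n : ℕ}
    (hM : M ^ n = 1) : m ^ n = 1 := by
  have := (aeval_eq_zero_iff_of_intertwines h₁ h₂ h (X ^ n - 1)).1 (by simp [hM])
  simpa [sub_eq_zero] using this

theorem iotaMat_intertwines (τ₁ τ₂ : ℂ) :
    iotaMat.map (algebraMap ℚ ℂ) * tangentBasis τ₁ τ₂ = tangentBasis τ₁ τ₂ *
      (!![1, 0; 0, -1] : Matrix (Fin 2) (Fin 2) ℂ) := by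
  ext i j
  rcases i with i | i <;> fin_cases i <;> fin_cases j <;>
    simp [iotaMat, tangentBasis, Matrix.mul_apply, Fintype.sum_sum_type, Fin.sum_univ_two]

namespace ActsUnitarily

variable {τ₁ τ₂ l₁ l₃ δ : ℂ} {M : Mat4}

theorem isIntegral (h : ActsUnitarily τ₁ τ₂ M l₁ l₃ δ) (h₁ : τ₁.im ≠ 0) (h₂ : τ₂.im ≠ 0)
    {n : ℕ} (hn : 0 < n) (hM : M ^ n = 1) :
    IsIntegral ℤ δ ∧ IsIntegral ℤ (l₁ + δ * conj l₁) := by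
  have hm := pow_eq_one_of_intertwines h₁ h₂ h.intertwines hM
  have ht := Matrix.isIntegral_trace_of_pow_eq_one hn hm
  have hd := Matrix.isIntegral_det_of_pow_eq_one hn hm
  rw [Matrix.trace_fin_two_of] at ht
  rw [Matrix.det_fin_two_of] at hd
  refine ⟨?_, ht⟩
  convert hd using 1
  linear_combination -δ * h.norm_col

/-- On the tangent plane, the commutator `ι M ι M⁻¹` has trace `4 |l₁|² - 2`. -/
theorem isIntegral_commutator (h : ActsUnitarily τ₁ τ₂ M l₁ l₃ δ) (h₁ : τ₁.im ≠ 0)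
    (h₂ : τ₂.im ≠ 0) {N : Mat4} (hN : N * M = 1) {n : ℕ} (hn : 0 < n)
    (hM : (iotaMat * M * (iotaMat * N)) ^ n = 1) : IsIntegral ℤ (4 * (l₁ * conj l₁) - 2) := by
  have hs := h.norm_col
  have hd := h.norm_det
  have hNi : N.map (algebraMap ℚ ℂ) * tangentBasis τ₁ τ₂ = tangentBasis τ₁ τ₂ *
      !![conj l₁, (τ₂.im / τ₁.im : ℝ) * conj l₃; -(conj δ * l₃), conj δ * l₁] := by
    have hmm : !![l₁, -((τ₂.im / τ₁.im : ℝ) * δ * conj l₃); l₃, δ * conj l₁] *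
        !![conj l₁, (τ₂.im / τ₁.im : ℝ) * conj l₃; -(conj δ * l₃), conj δ * l₁] = 1 := by
      generalize ((τ₂.im / τ₁.im : ℝ) : ℂ) = s at *
      rw [Matrix.mul_fin_two, Matrix.one_fin_two]
      have e₁ : l₁ * conj l₁ + -(s * δ * conj l₃) * -(conj δ * l₃) = 1 := by
        linear_combination hs + s * l₃ * conj l₃ * hd
      have e₂ : l₁ * (s * conj l₃) + -(s * δ * conj l₃) * (conj δ * l₁) = 0 := by
        linear_combination -s * l₁ * conj l₃ * hd
      have e₃ : l₃ * conj l₁ + δ * conj l₁ * -(conj δ * l₃) = 0 := by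
        linear_combination -l₃ * conj l₁ * hd
      have e₄ : l₃ * (s * conj l₃) + δ * conj l₁ * (conj δ * l₁) = 1 := by
        linear_combination hs + l₁ * conj l₁ * hd
      rw [e₁, e₂, e₃, e₄]
    have hNM : N.map (algebraMap ℚ ℂ) * M.map (algebraMap ℚ ℂ) = 1 := by
      rw [← Matrix.map_mul, hN]; simp
    calc N.map (algebraMap ℚ ℂ) * tangentBasis τ₁ τ₂
        = N.map (algebraMap ℚ ℂ) * (M.map (algebraMap ℚ ℂ) * tangentBasis τ₁ τ₂ *
            !![conj l₁, (τ₂.im / τ₁.im : ℝ) * conj l₃; -(conj δ * l₃), conj δ * l₁]) := by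
          rw [h.intertwines, Matrix.mul_assoc, hmm, Matrix.mul_one]
      _ = _ := by rw [Matrix.mul_assoc, ← Matrix.mul_assoc, hNM, Matrix.one_mul]
  have hι := iotaMat_intertwines τ₁ τ₂
  have hm := pow_eq_one_of_intertwines h₁ h₂ (map_mul_intertwines
    (map_mul_intertwines hι h.intertwines) (map_mul_intertwines hι hNi)) hM
  have ht := Matrix.isIntegral_trace_of_pow_eq_one hn hm
  convert ht using 1
  simp only [Matrix.mul_fin_two, Matrix.trace_fin_two_of]
  generalize ((τ₂.im / τ₁.im : ℝ) : ℂ) = s at *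
  linear_combination 2 * hs + (s * l₃ * conj l₃ - l₁ * conj l₁) * hd

/-- The rational algebraic integer `4 |l₁|² - 2` lies strictly between `-2` and `2`. -/
theorem norm_sq_cases (h : ActsUnitarily τ₁ τ₂ M l₁ l₃ δ) (h₁ : 0 < τ₁.im) (h₂ : 0 < τ₂.im)
    (hl₁ : l₁ ≠ 0) (hl₃ : l₃ ≠ 0) (hi : IsIntegral ℤ (4 * (l₁ * conj l₁) - 2)) :
    ∃ κ : ℚ, l₁ * conj l₁ = κ ∧ (κ = 1 / 4 ∨ κ = 1 / 2 ∨ κ = 3 / 4) := by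
  have hκ := (h.det₁₁ h₁.ne').symm
  refine ⟨_, hκ, ?_⟩
  generalize M.toBlocks₁₁.det = κ at hκ
  have hn := h.norm_col
  rw [hκ] at hi
  obtain ⟨j, hj⟩ := exists_int_of_isIntegral_ratCast (q := 4 * κ - 2) (by push_cast; exact hi)
  rw [Complex.mul_conj] at hκ hn
  rw [Complex.mul_conj] at hn
  have hκ' : Complex.normSq l₁ = κ := by exact_mod_cast hκ
  have hn' : Complex.normSq l₁ + τ₂.im / τ₁.im * Complex.normSq l₃ = 1 := by exact_mod_cast hn
  have p1 := Complex.normSq_pos.2 hl₁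
  have p3 := Complex.normSq_pos.2 hl₃
  have ps : 0 < τ₂.im / τ₁.im * Complex.normSq l₃ := by positivity
  have k0 : 0 < κ := by rw [hκ'] at p1; exact_mod_cast p1
  have k1 : κ < 1 := by
    have : (κ : ℝ) < 1 := by linarith
    exact_mod_cast this
  have j1 : -2 < j := by
    have : ((-2 : ℤ) : ℚ) < j := by rw [← hj]; push_cast; linarith
    exact_mod_cast this
  have j2 : j < 2 := by
    have : (j : ℚ) < (2 : ℤ) := by rw [← hj]; push_cast; linarith
    exact_mod_cast this
  interval_cases j <;> push_cast at hj
  · left; linarith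
  · right; left; linarith
  · right; right; linarith

end ActsUnitarily

/-! ### The classification of Type III automorphisms -/

/-- The blocks of a rational automorphism act on the vectors `(1, τ₁)` and `(1, τ₂)`, because the
tangent plane is preserved. -/
theorem GenHolonomySet.exists_acts (𝒳 : GenHolonomySet) {g : GL Coord ℚ}
    (hg : g ∈ 𝒳.rationalAut) : ∃ l₁ l₂ l₃ l₄ : ℂ,
      Acts (g : Mat4).toBlocks₁₁ 𝒳.τ₁ 𝒳.τ₁ l₁ ∧ Acts (g : Mat4).toBlocks₁₂ 𝒳.τ₂ 𝒳.τ₁ l₂ ∧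
      Acts (g : Mat4).toBlocks₂₁ 𝒳.τ₁ 𝒳.τ₂ l₃ ∧ Acts (g : Mat4).toBlocks₂₂ 𝒳.τ₂ 𝒳.τ₂ l₄ := by
  have hg' : (Matrix.GeneralLinearGroup.map (algebraMap ℚ ℂ)) g ∈
      germAut (holonomyGraph 𝒳.v₁ 𝒳.v₂) := hg
  have e : (((Matrix.GeneralLinearGroup.map (algebraMap ℚ ℂ)) g : GL Coord ℂ) :
      Matrix Coord Coord ℂ) = (g : Mat4).map (algebraMap ℚ ℂ) := rfl
  have h1 := 𝒳.mulVec_tangentVec hg' 1 0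
  have h2 := 𝒳.mulVec_tangentVec hg' 0 1
  rw [e] at h1 h2
  simp [tangentVec, Matrix.mulVec, dotProduct, Fintype.sum_sum_type, Fin.sum_univ_two] at h1 h2
  refine ⟨_, _, _, _, acts_iff.2 ⟨rfl, ?_⟩, acts_iff.2 ⟨rfl, ?_⟩, acts_iff.2 ⟨rfl, ?_⟩,
    acts_iff.2 ⟨rfl, ?_⟩⟩
  · exact h1.1.trans (mul_comm _ _)
  · exact h2.1.trans (mul_comm _ _)
  · exact h1.2.trans (mul_comm _ _)
  · exact h2.2.trans (mul_comm _ _)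

theorem Acts.mem {B : Mat2} {σ τ l : ℂ} (h : Acts B σ τ l) {K : IntermediateField ℚ ℂ}
    (hσ : σ ∈ K) : l ∈ K := by
  rw [← (acts_iff.1 h).1]
  exact add_mem (SubfieldClass.ratCast_mem _ _) (mul_mem (SubfieldClass.ratCast_mem _ _) hσ)

/-- What finiteness of the subgroups generated by `M` and by `ι M ι M⁻¹` gives for the action on the
tangent plane. -/
theorem GenHolonomySet.exists_actsUnitarily (𝒳 : GenHolonomySet) {g : GL Coord ℚ}
    (hg : g ∈ 𝒳.rationalAut) (hIII : IsTypeIII (g : Mat4)) :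
    ∃ (l₁ l₃ δ : ℂ) (κ : ℚ), ActsUnitarily 𝒳.τ₁ 𝒳.τ₂ (g : Mat4) l₁ l₃ δ ∧ l₃ ≠ 0 ∧
      l₁ * conj l₁ = κ ∧ (κ = 1 / 4 ∨ κ = 1 / 2 ∨ κ = 3 / 4) ∧ IsIntegral ℤ δ ∧
      IsIntegral ℤ (l₁ + δ * conj l₁) ∧ ∀ K, 𝒳.CuspShapesIn K → l₁ ∈ K ∧ δ ∈ K := by
  obtain ⟨l₁, l₂, l₃, l₄, a, b, c, d⟩ := 𝒳.exists_acts hg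
  obtain ⟨h, z1, z3⟩ :=
    ActsUnitarily.of_isTypeIII 𝒳.im_pos₁.ne' 𝒳.im_pos₂.ne' a b c d hIII
  obtain ⟨n, hn, hgn⟩ := 𝒳.exists_pow_eq_one hg
  have hι := 𝒳.iotaGL_mem
  obtain ⟨n', hn', hgn'⟩ := 𝒳.exists_pow_eq_one
    (mul_mem (mul_mem hι hg) (mul_mem hι (inv_mem hg)))
  have hM : (g : Mat4) ^ n = 1 := by
    have := congrArg (Units.val) hgn
    simpa using this
  have hM' : (iotaMat * (g : Mat4) * (iotaMat * ((g⁻¹ : GL Coord ℚ) : Mat4))) ^ n' = 1 :=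
    congrArg (Units.val) hgn'
  have hN : ((g⁻¹ : GL Coord ℚ) : Mat4) * (g : Mat4) = 1 := g.inv_mul
  obtain ⟨i1, i2⟩ := h.isIntegral 𝒳.im_pos₁.ne' 𝒳.im_pos₂.ne' hn hM
  obtain ⟨κ, hκ, hκ'⟩ := h.norm_sq_cases 𝒳.im_pos₁ 𝒳.im_pos₂ z1 z3
    (h.isIntegral_commutator 𝒳.im_pos₁.ne' 𝒳.im_pos₂.ne' hN hn' hM')
  exact ⟨l₁, l₃, _, κ, h, z3, hκ, hκ', i1, i2, fun K hK => ⟨a.mem hK.1,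
    sub_mem (mul_mem (a.mem hK.1) (d.mem hK.2)) (mul_mem (b.mem hK.2) (c.mem hK.1))⟩⟩

namespace ActsUnitarily

variable {τ₁ τ₂ l₁ l₃ δ : ℂ} {M : Mat4}

theorem formsScalar (h : ActsUnitarily τ₁ τ₂ M l₁ l₃ δ) (h₁ : τ₁.im ≠ 0) (h₂ : τ₂.im ≠ 0)
    (hl₃ : l₃ ≠ 0) (hIII : IsTypeIII M) {σ ε : ℚ} (hs : SignDet l₁ δ σ ε (1 / 4)) (hε : IsSign ε)
    (hl₁ : l₁ = -(ε / 2 : ℚ)) : FormsScalar M := by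
  obtain ⟨hσ, rfl, hx, hκ⟩ := hs
  have hdet : M.toBlocks₁₂.det = 3 / 4 := by
    have := h.det₁₂ h₁ h₂
    rw [hκ] at this
    have e : (M.toBlocks₁₂.det : ℂ) = ((3 / 4 : ℚ) : ℂ) := by rw [this]; norm_num
    exact_mod_cast e
  have h11 : M.toBlocks₁₁ = (-(ε / 2)) • 1 := by
    refine h.acts₁₁.unique h₁ ((Acts.one.smul _).congr ?_)
    rw [hl₁]; push_cast; ring
  have h22 : M.toBlocks₂₂ = (-(σ * ε / 2)) • 1 := by
    refine h.acts₂₂.unique h₂ ((Acts.one.smul _).congr ?_)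
    rw [hl₁, map_neg, map_ratCast]; push_cast; ring
  have h21 : M.toBlocks₂₁ = (-(σ * (3 / 4))) • M.toBlocks₁₂⁻¹ := by
    refine h.acts₂₁.unique h₁ (((h.acts_inv₁₂ h₁ h₂ hl₃ hIII hκ).smul _).congr ?_)
    have hσ2 : (σ : ℂ) ^ 2 = 1 := by rcases hσ with rfl | rfl <;> simp
    rw [map_ratCast]
    push_cast
    norm_num
    linear_combination l₃ * hσ2
  have hM := M.fromBlocks_toBlocks.symm
  rw [h11, h21, h22] at hM
  have hd0 : M.toBlocks₁₂.det ≠ 0 := hIII.1.2.1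
  rcases hσ with rfl | rfl
  · rw [Rat.cast_one] at h
    have hm := h.minpoly_of_det_eq_one h₁ h₂ hl₃ hx
    rcases hε with rfl | rfl
    · refine Or.inr (Or.inl ⟨by simpa using hm,
        Matrix.GeneralLinearGroup.mkOfDetNeZero _ hd0, hdet, ?_⟩)
      refine hM.trans ?_
      change _ = Matrix.fromBlocks _ M.toBlocks₁₂ (-((3 / 4 : ℚ) • M.toBlocks₁₂⁻¹)) _
      norm_num
    · refine Or.inr (Or.inr ⟨by simpa [sub_eq_add_neg] using hm,
        Matrix.GeneralLinearGroup.mkOfDetNeZero (-M.toBlocks₁₂) (by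
          rw [Matrix.det_neg]; simpa using hd0), ?_, ?_⟩)
      · change (-M.toBlocks₁₂).det = _
        rw [Matrix.det_neg, hdet]; norm_num
      · have hinv : (-M.toBlocks₁₂)⁻¹ = -M.toBlocks₁₂⁻¹ := by
          refine Matrix.inv_eq_right_inv ?_
          rw [neg_mul_neg, Matrix.mul_nonsing_inv _ (isUnit_iff_ne_zero.2 hd0)]
        refine hM.trans ?_
        change _ = Matrix.fromBlocks _ (-(-M.toBlocks₁₂)) ((3 / 4 : ℚ) • (-M.toBlocks₁₂)⁻¹) _
        rw [hinv]
        norm_num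
  · rw [Rat.cast_neg, Rat.cast_one] at h
    have hm := h.minpoly_eq_quadratic (a := 0) (b := -1) h₁ h₂ hl₃
      (by rw [hl₁, map_neg, map_ratCast]; simp) (by simp)
    refine Or.inl ⟨by simpa [sub_eq_add_neg] using hm, -ε,
      Matrix.GeneralLinearGroup.mkOfDetNeZero _ hd0, ?_, hdet, ?_⟩
    · rcases hε with rfl | rfl <;> norm_num [IsSign]
    · refine hM.trans ?_
      change _ = Matrix.fromBlocks _ M.toBlocks₁₂ ((3 / 4 : ℚ) • M.toBlocks₁₂⁻¹) _
      congr 1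
      · rw [neg_div]
      · norm_num
      · rw [← neg_smul]; congr 1; ring

end ActsUnitarily

theorem isSquare_of_mul_sq_eq {D q r : ℚ} (h : D * q ^ 2 = r) : IsSquare (r * D) :=
  ⟨D * q, by rw [← h]; ring⟩

theorem theorem9p4 (𝒳 : GenHolonomySet)
    (hK : ∃ K : IntermediateField ℚ ℂ, Module.finrank ℚ K = 2 ∧ 𝒳.CuspShapesIn K)
    (g : GL Coord ℚ) (hg : g ∈ 𝒳.rationalAut)
    (M : Mat4) (hM : M = (g : Mat4)) (hIII : IsTypeIII M) :
    (¬ IsScalarMat M.toBlocks₁₁ →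
      (𝒳.CuspShapesIn (imagQuadField 3) ∨ 𝒳.CuspShapesIn (imagQuadField 2) ∨
        𝒳.CuspShapesIn (imagQuadField 1)) ∧
      (𝒳.CuspShapesIn (imagQuadField 3) → FormsSqrtNegThree M) ∧
      (𝒳.CuspShapesIn (imagQuadField 2) → FormsSqrtNegTwo M) ∧
      (𝒳.CuspShapesIn (imagQuadField 1) → FormsSqrtNegOne M)) ∧
    (IsScalarMat M.toBlocks₁₁ → FormsScalar M) := by
  subst hM
  obtain ⟨l₁, l₃, δ, κ, h, hl₃, hκ, hκ', hδi, hti, hmem⟩ := 𝒳.exists_actsUnitarily hg hIII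
  have h₁ := 𝒳.im_pos₁.ne'
  have h₂ := 𝒳.im_pos₂.ne'
  have hcl : ∀ {D x y z w : ℚ}, 0 < D → l₁ = x + y * sqrtNeg D → δ = z + w * sqrtNeg D →
      MultiplierCases l₁ δ D y w κ := fun hD hx hz =>
    multiplierCases_of_isIntegral (sqrtNeg_sq hD) (conj_sqrtNeg _) hD hx hz h.norm_det hκ hκ'
      hδi hti
  obtain ⟨K, hK2, hKτ⟩ := hK
  obtain ⟨D, hD, hcoord⟩ := exists_rat_coords hK2 hKτ.1 𝒳.im_pos₁
  obtain ⟨z, w, hzw⟩ := hcoord δ (hmem K hKτ).2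
  refine ⟨fun hns => ?_, fun ⟨c, hc⟩ => ?_⟩
  · obtain ⟨x, y, hxy⟩ := hcoord l₁ (hmem K hKτ).1
    have hl₁ : l₁.im ≠ 0 := by
      intro h0
      have hy : y = 0 := by
        rw [hxy] at h0
        simpa [sqrtNeg_im_ne_zero hD] using h0
      rw [hy, Rat.cast_zero, zero_mul, add_zero] at hxy
      exact hns ⟨x, h.acts₁₁.unique h₁ ((Acts.one.smul x).congr (by rw [hxy, mul_one]))⟩
    have hfield : ∀ {d : ℕ} {q : ℚ}, 0 < d → D * q ^ 2 = d →
        𝒳.CuspShapesIn (imagQuadField d) := fun hd hq =>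
      ⟨mem_imagQuadField hD hd hq (hcoord _ hKτ.1), mem_imagQuadField hD hd hq (hcoord _ hKτ.2)⟩
    have hkey : ∀ {d : ℕ}, 0 < d → 𝒳.CuspShapesIn (imagQuadField d) →
        ∃ y w : ℚ, y ≠ 0 ∧ MultiplierCases l₁ δ d y w κ := fun {d} hd hτ => by
      obtain ⟨x, y, hxy⟩ := imagQuadField_coords hd (hmem _ hτ).1
      obtain ⟨z, w, hzw⟩ := imagQuadField_coords hd (hmem _ hτ).2
      refine ⟨y, w, ?_, hcl (by exact_mod_cast hd) hxy hzw⟩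
      rintro rfl
      apply hl₁
      rw [hxy]
      simp
    refine ⟨?_, fun hτ => ?_, fun hτ => ?_, fun hτ => ?_⟩
    · rcases hcl hD hxy hzw with ⟨σ, -, e⟩ | ⟨σ, ε, -, -, e⟩ | ⟨σ, ε, -, ⟨-, e⟩ | ⟨-, e⟩⟩
      · rcases hκ' with rfl | rfl | rfl
        · exact Or.inr (Or.inr (hfield one_pos (e.trans (by norm_num))))
        · exact Or.inr (Or.inl (hfield two_pos (e.trans (by norm_num))))
        · exact Or.inl (hfield three_pos (e.trans (by norm_num)))
      · rcases hκ' with rfl | rfl | rfl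
        · have hy : y = 0 := by simpa [hD.ne'] using e
          exact absurd (by rw [hxy, hy]; simp) hl₁
        · exact Or.inr (Or.inr (hfield one_pos (e.trans (by norm_num))))
        · exact Or.inr (Or.inl (hfield two_pos (e.trans (by norm_num))))
      · exact Or.inr (Or.inr (hfield one_pos (e.trans (by norm_num))))
      · exact Or.inl (hfield three_pos (e.trans (by norm_num)))
    · obtain ⟨y, w, hy, hc⟩ := hkey three_pos hτ
      refine h.formsSqrtNegThree h₁ h₂ hl₁ hl₃ hIII ?_
      rcases hc with ⟨σ, hs, e⟩ | ⟨σ, ε, -, -, e⟩ | ⟨σ, ε, hs, ⟨-, e⟩ | ⟨hk, -⟩⟩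
      · rcases hκ' with rfl | rfl | rfl
        · have := isSquare_of_mul_sq_eq e; norm_num at this
        · have := isSquare_of_mul_sq_eq e; norm_num at this
        · exact Or.inl ⟨σ, hs⟩
      · rcases hκ' with rfl | rfl | rfl
        · exact absurd (by simpa using e) hy
        · have := isSquare_of_mul_sq_eq e; norm_num at this
        · have := isSquare_of_mul_sq_eq e; norm_num at this
      · have := isSquare_of_mul_sq_eq e; norm_num at this
      · exact Or.inr ⟨σ, ε, κ, hs, hk⟩
    · obtain ⟨y, w, hy, hc⟩ := hkey two_pos hτ
      refine h.formsSqrtNegTwo h₁ h₂ hl₁ hl₃ hIII ?_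
      rcases hc with ⟨σ, hs, e⟩ | ⟨σ, ε, hε, hs, e⟩ | ⟨σ, ε, hs, ⟨-, e⟩ | ⟨-, e⟩⟩
      · rcases hκ' with rfl | rfl | rfl
        · have := isSquare_of_mul_sq_eq e; norm_num at this
        · exact Or.inl ⟨σ, hs⟩
        · have := isSquare_of_mul_sq_eq e; norm_num at this
      · rcases hκ' with rfl | rfl | rfl
        · exact absurd (by simpa using e) hy
        · have := isSquare_of_mul_sq_eq e; norm_num at this
        · exact Or.inr ⟨σ, ε, hε, hs⟩
      · have := isSquare_of_mul_sq_eq e; norm_num at this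
      · have := isSquare_of_mul_sq_eq e; norm_num at this
    · obtain ⟨y, w, hy, hc⟩ := hkey one_pos hτ
      refine h.formsSqrtNegOne h₁ h₂ hl₁ hl₃ hIII ?_
      rcases hc with ⟨σ, hs, e⟩ | ⟨σ, ε, hε, hs, e⟩ | ⟨σ, ε, hs, ⟨rfl, -⟩ | ⟨-, e⟩⟩
      · rcases hκ' with rfl | rfl | rfl
        · exact Or.inl ⟨σ, hs⟩
        · have := isSquare_of_mul_sq_eq e; norm_num at this
        · have := isSquare_of_mul_sq_eq e; norm_num at this
      · rcases hκ' with rfl | rfl | rfl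
        · exact absurd (by simpa using e) hy
        · exact Or.inr (Or.inl ⟨σ, ε, hε, hs⟩)
        · have := isSquare_of_mul_sq_eq e; norm_num at this
      · exact Or.inr (Or.inr ⟨σ, ε, hs⟩)
      · have := isSquare_of_mul_sq_eq e; norm_num at this
  · have hlc : l₁ = c := by
      have := h.acts₁₁
      rw [hc] at this
      simpa using this.eq_multiplier (Acts.one.smul c)
    have hκ0 : κ ≠ 0 := by rcases hκ' with rfl | rfl | rfl <;> norm_num
    have hconj : conj l₁ = l₁ := by rw [hlc, map_ratCast]
    rcases hcl hD (x := c) (y := 0) (by simpa using hlc) hzw with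
      ⟨σ, -, e⟩ | ⟨σ, ε, hε, hs, e⟩ | ⟨σ, ε, hs, e⟩
    · exact absurd (by linarith) hκ0
    · obtain rfl : κ = 1 / 4 := by linarith
      refine h.formsScalar h₁ h₂ hl₃ hIII hs hε ?_
      have := hs.add_conj
      rw [hconj] at this
      push_cast
      linear_combination this / 2
    · have hw : w = 0 := by
        have hκc : (κ : ℂ) ≠ 0 := by exact_mod_cast hκ0
        have hδσ : δ = σ := by
          have hk := hs.mul_conj
          rw [hconj, ← sq] at hk
          rw [hs.det_eq, hk, div_self hκc, mul_one]
        have := congrArg Complex.im (hzw.symm.trans hδσ)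
        simpa [sqrtNeg_im_ne_zero hD] using this
      rcases e with ⟨-, e⟩ | ⟨-, e⟩ <;> norm_num [hw] at e
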